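/- Let $\mathbf x$ and $\mathbf u$ be random vectors with values in $\mathcal X=\mathbb R^{T_1}$ and $\mathcal U=\mathbb R^{T_2}$ ($T_1,T_2\ge 1$) having a Lebesgue measurable joint density $p(x,u)\ge 0$ with respect to Lebesgue measure. Let $p(x)=\int_{\mathcal U} p(x,u)\,du$ and $p(u)=\int_{\mathcal X}p(x,u)\,dx$ be the marginal densities, $p(u|x)=p(x,u)/p(x)$ and $p(x|u)=p(x,u)/p(u)$ the conditional densities, and define the cross densities $$p(x,x')=\int_{\mathcal U}p(x'|u)\,p(u|x)\,p(x)\,du,\qquad p(u,u')=\int_{\mathcal X}p(u'|x)\,p(x|u)\,p(u)\,dx,$$ and the kernels $$K(x,x')=\frac{p(x,x')}{p(x)^{1/2}p(x')^{1/2}},\qquad K(u,u')=\frac{p(u,u')}{p(u)^{1/2}p(u')^{1/2}}$$ with values in $[0,\infty]$, where a kernel is taken to be $0$ at points where a marginal density in its denominator vanishes. Assume that $K(x,x')$ is square-integrable: $\int_{\mathcal X}\int_{\mathcal X}K(x,x')^2\,dx\,dx'<\infty$. Then there is a sequence $\lambda_1\ge\lambda_2\ge\dots\ge 0$ with the following properties.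 1. There are functions $\phi_1,\phi_2,\dots\in L^2(\mathcal X)$ with $\int_{\mathcal X}\phi_i\phi_j\,dx=\delta_{ij}$ that are eigenfunctions of the operator $T\varphi(x)=\int_{\mathcal X}K(x,x')\varphi(x')\,dx'$, namely $T\phi_i=\lambda_i\phi_i$ almost everywhere (the integral converging absolutely for almost every $x$), and $$K(x,x')=\sum_{i=1}^\infty\lambda_i\,\phi_i(x)\,\phi_i(x').$$ The series converges in $L^2(\mathcal X\times\mathcal X)$. Moreover there is a null set $N\subset\mathcal X$ such that for all $x,x'\in\mathcal X\setminus N$ with $K(x,x)<\infty$ and $K(x',x')<\infty$ the value $K(x,x')$ is finite and the series converges to it absolutely. 2. With the same eigenvalues $\lambda_i$, there is an orthonormal sequence $\psi_1,\psi_2,\dots\in L^2(\mathcal U)$ of eigenfunctions of the integral operator with kernel $K(u,u')$ for which $K(u,u')=\sum_i\lambda_i\psi_i(u)\psi_i(u')$ in the same senses. 3. The sequence $(\lambda_i)$ is the only one with property 1, and the only one for which functions $\psi_i$ as in 2 exist. For each of the two operators, a real number $c\neq 0$ is an eigenvalue on $L^2$ if and only if $c=\lambda_i$ for some $i$. In particular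 the two operators have the same nonzero eigenvalues. 4. The eigenspectrum is a measure of statistical dependence in the following sense: $\lambda_1=1$, and $\mathbf x$ and $\mathbf u$ are independent if and only if $\lambda_i=0$ for all $i\ge 2$. -/

import Mathlib

open MeasureTheory ProbabilityTheory Filter Topology
open scoped ENNReal NNReal

namespace CrossDensity

noncomputable section

/-- The marginal density `p(x) = ∫ p(x, u) du` of the first variable of a joint density.
The marginal density `p(u)` of the second variable is `marginal (Function.swap p) u`. -/
def marginal {α β : Type*} [MeasureSpace β] (p : α → β → ℝ≥0) (x : α) : ℝ≥0∞ :=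
  ∫⁻ u, (p x u : ℝ≥0∞)

/-- The conditional density `p(u | x) = p(x, u) / p(x)`.
The conditional density `p(x | u)` is `condDensity (Function.swap p) u x`. -/
def condDensity {α β : Type*} [MeasureSpace β] (p : α → β → ℝ≥0) (x : α) (u : β) : ℝ≥0∞ :=
  (p x u : ℝ≥0∞) / marginal p x

/-- The cross density `p(x, x') = ∫ p(x' | u) p(u | x) p(x) du`.
The cross density `p(u, u')` is `crossDensity (Function.swap p) u u'`. -/
def crossDensity {α β : Type*} [MeasureSpace α] [MeasureSpace β] (p : α → β → ℝ≥0)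
    (x x' : α) : ℝ≥0∞ :=
  ∫⁻ u, condDensity (Function.swap p) u x' * condDensity p x u * marginal p x

/-- The cross density kernel function `K(x, x') = p(x, x') / (p(x)^(1/2) p(x')^(1/2))`, with
values in `[0, ∞]`; it is `0` when `p(x) = 0` or `p(x') = 0`.
The kernel `K(u, u')` is `crossKernel (Function.swap p) u u'`. -/
def crossKernel {α β : Type*} [MeasureSpace α] [MeasureSpace β] (p : α → β → ℝ≥0)
    (x x' : α) : ℝ≥0∞ :=
  crossDensity p x x' / (marginal p x ^ (1 / 2 : ℝ) * marginal p x' ^ (1 / 2 : ℝ))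

/-- `φ` solves `T φ = c φ` almost everywhere, where `T φ (x) = ∫ K(x, x') φ(x') dx'`;
the integral is required to converge absolutely for almost every `x`. -/
def IsEigenpair {α : Type*} [MeasureSpace α] (K : α → α → ℝ≥0∞) (c : ℝ) (φ : α → ℝ) : Prop :=
  ∀ᵐ x, Integrable (fun x' => (K x x').toReal * φ x') ∧
    ∫ x', (K x x').toReal * φ x' = c * φ x

/-- `c` is an eigenvalue on `L²` of the integral operator with kernel `K`. -/
def IsEigenvalue {α : Type*} [MeasureSpace α] (K : α → α → ℝ≥0∞) (c : ℝ) : Prop :=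
  ∃ φ : α → ℝ, MemLp φ 2 ∧ ¬ (φ =ᵐ[volume] 0) ∧ IsEigenpair K c φ

/-- `φ 0, φ 1, …` are orthonormal eigenfunctions in `L²` of the integral operator with kernel `K`,
with eigenvalues `lam 0 ≥ lam 1 ≥ … ≥ 0`, and `K(x, x') = ∑ lam i φ_i(x) φ_i(x')`. -/
structure IsMercerExpansion {α : Type*} [MeasureSpace α] (K : α → α → ℝ≥0∞)
    (lam : ℕ → ℝ) (φ : ℕ → α → ℝ) : Prop where
  memLp : ∀ i, MemLp (φ i) 2
  orthonormal : ∀ i j, ∫ x, φ i x * φ j x = if i = j then 1 else 0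
  nonneg : ∀ i, 0 ≤ lam i
  antitone : Antitone lam
  eigen : ∀ i, IsEigenpair K (lam i) (φ i)
  /-- The series converges to `K` in `L²` of the product space. -/
  expansion_L2 : Tendsto
    (fun n : ℕ => eLpNorm (fun z : α × α =>
      (K z.1 z.2).toReal - ∑ i ∈ Finset.range n, lam i * φ i z.1 * φ i z.2) 2 volume)
    atTop (𝓝 0)
  /-- Off a null set, the series converges absolutely to `K(x, x')` for all `x` and `x'` at which
  the diagonal of `K` is finite. -/
  expansion_pointwise : ∃ N : Set α, volume N = 0 ∧ ∀ x ∉ N, ∀ x' ∉ N,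
    K x x ≠ ∞ → K x' x' ≠ ∞ →
      K x x' ≠ ∞ ∧ HasSum (fun i => lam i * φ i x * φ i x') (K x x').toReal

end

end CrossDensity

/-!
Let `g(x, u) = p(x, u) / (p(x)^(1/2) p(u)^(1/2))` (`rootKernel`) and let `G : L²(U) → L²(X)` be the
integral operator with kernel `g`. By the Cauchy–Schwarz inequality `G` is a contraction
(`IsJointDensity.isContractiveKernel`); its adjoint has the transposed kernel
(`IsContractiveKernel.inner_op`). Off null sets, the two cross density kernels are
`∫ g(x, u) g(x', u) du` and `∫ g(x, u) g(x, u') dx`, the kernels of `G G*` and `G* G`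
(`IsJointDensity.exists_null_crossKernel_eq`, `IsContractiveKernel.gramOp_ae`). Everything follows
from this factorization. The operator `G` itself need not be Hilbert–Schmidt, which is why the
diagonal of the kernel may be infinite.

* The kernels of `G G*` and `G* G` have the same `L²` norm, so both operators are positive with a
  square-integrable kernel and map weakly convergent sequences to norm convergent ones. Maximizing
  the quadratic form over successive orthogonal complements gives eigenvalues
  `lam 0 ≥ lam 1 ≥ …` with orthonormal eigenvectors, and the operator vanishes on the orthogonal
  complement of these (`exists_isSpectralSequence`). As `L²` is infinite-dimensional, the sequence
  never ends; eigenvectors of the eigenvalue `0` fill it up if there are finitely many others.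
* The Courant–Fischer argument shows that any spectral sequence of `G G*` and any of `G* G` have the
  same eigenvalues (`IsSpectralSequence.eq_of_adjoint`). As a Mercer expansion yields a spectral
  sequence (`IsContractiveKernel.isSpectralSequence_of_isMercerExpansion`), this gives both the
  equality of the two spectra and uniqueness.
* Almost every row `K(x, ·)` lies in the closed span of the eigenfunctions, and its expansion has
  the coefficients `lam i * φ i x`; integrating over `x` gives convergence in `L²` of the product
  (`IsContractiveKernel.tendsto_expansion`). For the pointwise statement, finiteness of `K(x, x)`
  means that the row `g(x, ·)` is in `L²(U)`. Outside a null set such a row is orthogonal to the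
  kernel of `G`, hence in the closed span of the `G* φ i`, and Parseval's identity for
  `K(x, x') = ⟪g(x, ·), g(x', ·)⟫` is the expansion (`IsContractiveKernel.exists_null_hasSum`).
* `G` and `G*` exchange the unit vectors `p(u)^(1/2)` and `p(x)^(1/2)`, so `1` is an eigenvalue, the
  largest one because `G` is a contraction. All others vanish if and only if `G` is the rank one
  operator given by these two vectors. Testing this on `p(x)^(1/2)` and `p(u)^(1/2)` restricted to
  measurable sets, it says that the joint law is the product of the marginal laws
  (`IsJointDensity.indepFun_iff`).
-/

open scoped RealInnerProductSpace

namespace CrossDensity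

/-! ### Positive completely continuous operators -/

section Hilbert

variable {H H' : Type*} [NormedAddCommGroup H] [InnerProductSpace ℝ H]
  [NormedAddCommGroup H'] [InnerProductSpace ℝ H']

/-- Parseval's identity for an orthonormal family that need not be a basis: it suffices that `v` is
orthogonal to everything orthogonal to the family. -/
lemma hasSum_inner_mul_inner_of_orthonormal [CompleteSpace H] {ι : Type*} {e : ι → H}
    (he : Orthonormal ℝ e) {v : H}
    (hv : ∀ h, (∀ i, ⟪e i, h⟫ = 0) → ⟪v, h⟫ = 0) (w : H) :
    HasSum (fun i => ⟪e i, v⟫ * ⟪e i, w⟫) ⟪v, w⟫ := by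
  classical
  -- extended to a Hilbert basis, the family leaves only basis vectors orthogonal to `v`
  obtain ⟨S, b, hS, hb⟩ := he.toSubtypeRange.exists_hilbertBasis_extension
  have hsum := b.hasSum_inner_mul_inner v w
  have hsub : Function.Injective (fun i => (⟨e i, hS ⟨i, rfl⟩⟩ : S)) := by
    intro i j hij
    exact he.linearIndependent.injective (congrArg Subtype.val hij)
  have hzero : ∀ s ∉ Set.range (fun i => (⟨e i, hS ⟨i, rfl⟩⟩ : S)),
      ⟪v, b s⟫ * ⟪b s, w⟫ = 0 := by
    intro s hs
    rw [hv, zero_mul]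
    intro i
    have h1 : b ⟨e i, hS ⟨i, rfl⟩⟩ = e i := by rw [hb]
    rw [← h1]
    exact b.orthonormal.2 fun h => hs ⟨i, h⟩
  have := (hsub.hasSum_iff hzero).2 hsum
  refine this.congr_fun ?_
  intro i
  simp [hb, real_inner_comm]

/-- A bounded sequence in a separable Hilbert space has a weakly convergent subsequence. -/
lemma exists_weakly_convergent_subseq [CompleteSpace H] [TopologicalSpace.SeparableSpace H]
    (w : ℕ → H) (hw : ∀ n, ‖w n‖ ≤ 1) :
    ∃ a : H, ‖a‖ ≤ 1 ∧ ∃ k : ℕ → ℕ, StrictMono k ∧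
      ∀ v, Tendsto (fun n => ⟪w (k n), v⟫) atTop (𝓝 ⟪a, v⟫) := by
  have hc := WeakDual.isSeqCompact_closedBall ℝ H 0 1
  obtain ⟨f, hf, k, hk, hlim⟩ := hc
    (x := fun n => StrongDual.toWeakDual (InnerProductSpace.toDual ℝ H (w n)))
    (by intro n; simpa using hw n)
  obtain ⟨a, ha⟩ := (InnerProductSpace.toDual ℝ H).surjective (WeakDual.toStrongDual f)
  refine ⟨a, ?_, k, hk, fun v => ?_⟩
  · have : ‖WeakDual.toStrongDual f‖ ≤ 1 := by simpa using hf
    rwa [← ha, LinearIsometryEquiv.norm_map] at this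
  · have h1 := (WeakDual.eval_continuous (𝕜 := ℝ) (E := H) v).tendsto f
    have h2 := h1.comp hlim
    have h3 : f v = ⟪a, v⟫ := by
      have : WeakDual.toStrongDual f v = ⟪a, v⟫ := by rw [← ha]; simp
      exact this
    rw [h3] at h2
    refine h2.congr fun n => ?_
    simp

/-- A bounded operator that maps bounded weakly convergent sequences to norm convergent ones. -/
def IsCompletelyContinuous (T : H →L[ℝ] H) : Prop :=
  ∀ (w : ℕ → H) (a : H), (∀ n, ‖w n‖ ≤ 1) →
    (∀ v, Tendsto (fun n => ⟪w n, v⟫) atTop (𝓝 ⟪a, v⟫)) →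
    Tendsto (fun n => T (w n)) atTop (𝓝 (T a))

/-- A nonnegative symmetric form on a subspace annihilates its isotropic vectors. -/
lemma form_eq_zero_of_isotropic {T : H →L[ℝ] H} (hsym : ∀ x y, ⟪T x, y⟫ = ⟪x, T y⟫)
    {V : Submodule ℝ H} (hpos : ∀ x ∈ V, 0 ≤ ⟪T x, x⟫) {x y : H} (hx : x ∈ V) (hy : y ∈ V)
    (h0 : ⟪T x, x⟫ = 0) : ⟪T x, y⟫ = 0 := by
  -- the form is nonnegative on the line through `x` in direction `y`
  have key : ∀ t : ℝ, 0 ≤ ⟪T y, y⟫ * (t * t) + (2 * ⟪T x, y⟫) * t + 0 := by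
    intro t
    have h := hpos (x + t • y) (V.add_mem hx (V.smul_mem t hy))
    have h1 : ⟪T y, x⟫ = ⟪T x, y⟫ := by rw [hsym y x, real_inner_comm]
    simp only [map_add, map_smul, inner_add_left, inner_add_right, inner_smul_left,
      inner_smul_right, h0, h1, RCLike.conj_to_real] at h
    linarith
  have hd := discrim_le_zero key
  rw [discrim] at hd
  nlinarith [sq_nonneg ⟪T x, y⟫]

/-- One step of the spectral theorem: on the orthogonal complement of a finite set of eigenvectors,
the quadratic form of `T` attains its maximum over the unit sphere, at an eigenvector. The maximum
is a weak limit of a maximizing sequence. -/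
lemma exists_maximal_eigenvector [CompleteSpace H]
    [TopologicalSpace.SeparableSpace H] (hfin : ¬ FiniteDimensional ℝ H)
    {T : H →L[ℝ] H} (hsym : ∀ x y, ⟪T x, y⟫ = ⟪x, T y⟫) (hpos : ∀ x, 0 ≤ ⟪T x, x⟫)
    (hT : IsCompletelyContinuous T) (S : Finset H) (hS : ∀ f ∈ S, ∃ c : ℝ, T f = c • f) :
    ∃ q : H × ℝ, ‖q.1‖ = 1 ∧ (∀ f ∈ S, ⟪f, q.1⟫ = 0) ∧ T q.1 = q.2 • q.1 ∧
      ∀ w, (∀ f ∈ S, ⟪f, w⟫ = 0) → ⟪T w, w⟫ ≤ q.2 * ‖w‖ ^ 2 := by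
  set V : Submodule ℝ H := (Submodule.span ℝ (S : Set H))ᗮ with hV
  have hVmem : ∀ w, w ∈ V ↔ ∀ f ∈ S, ⟪f, w⟫ = 0 := by
    intro w
    rw [hV, Submodule.mem_orthogonal]
    refine ⟨fun h f hf => h f (Submodule.subset_span hf), fun h u hu => ?_⟩
    have : Submodule.span ℝ (S : Set H) ≤ LinearMap.ker (innerₛₗ ℝ w) := by
      rw [Submodule.span_le]
      intro f hf
      simpa [real_inner_comm] using h f hf
    have := this hu
    simpa [real_inner_comm] using this
  have hTV : ∀ w ∈ V, T w ∈ V := by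
    intro w hw
    rw [hVmem] at hw ⊢
    intro f hf
    obtain ⟨c, hc⟩ := hS f hf
    rw [← hsym, hc, inner_smul_left, hw f hf, mul_zero]
  obtain ⟨v₀, hv₀V, hv₀⟩ : ∃ v ∈ V, ‖v‖ = 1 := by
    have hne : V ≠ ⊥ := by
      intro h
      have hfd : FiniteDimensional ℝ (Submodule.span ℝ (S : Set H)) :=
        FiniteDimensional.span_of_finite ℝ S.finite_toSet
      rw [hV, Submodule.orthogonal_eq_bot_iff] at h
      rw [h] at hfd
      exact hfin (Module.Finite.equiv (Submodule.topEquiv (R := ℝ) (M := H)))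
    obtain ⟨v, hv, hv0⟩ := V.ne_bot_iff.1 hne
    exact ⟨‖v‖⁻¹ • v, V.smul_mem _ hv, norm_smul_inv_norm hv0⟩
  set A : Set ℝ := (fun w => ⟪T w, w⟫) '' {w | w ∈ V ∧ ‖w‖ = 1} with hA
  have hAne : A.Nonempty := ⟨_, v₀, ⟨hv₀V, hv₀⟩, rfl⟩
  have hAbd : BddAbove A := by
    refine ⟨‖T‖, ?_⟩
    rintro _ ⟨w, ⟨-, hw⟩, rfl⟩
    calc ⟪T w, w⟫ ≤ ‖T w‖ * ‖w‖ := real_inner_le_norm _ _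
      _ ≤ ‖T‖ * ‖w‖ * ‖w‖ := by gcongr; exact T.le_opNorm w
      _ = ‖T‖ := by rw [hw]; ring
  set s := sSup A with hs
  have hle : ∀ w ∈ V, ⟪T w, w⟫ ≤ s * ‖w‖ ^ 2 := by
    intro w hw
    rcases eq_or_ne w 0 with rfl | hw0
    · simp
    have h1 : ⟪T (‖w‖⁻¹ • w), ‖w‖⁻¹ • w⟫ ≤ s :=
      le_csSup hAbd ⟨_, ⟨V.smul_mem _ hw, norm_smul_inv_norm hw0⟩, rfl⟩
    have hn : 0 < ‖w‖ := norm_pos_iff.2 hw0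
    simp only [map_smul, inner_smul_left, inner_smul_right, RCLike.conj_to_real] at h1
    field_simp at h1
    linarith
  have hs0 : 0 ≤ s := (hpos v₀).trans (le_csSup hAbd ⟨v₀, ⟨hv₀V, hv₀⟩, rfl⟩)
  -- the maximum is attained
  obtain ⟨v, hvV, hv1, hvs⟩ : ∃ v ∈ V, ‖v‖ = 1 ∧ ⟪T v, v⟫ = s := by
    rcases hs0.eq_or_lt with h0 | hspos
    · refine ⟨v₀, hv₀V, hv₀, le_antisymm ?_ ?_⟩
      · simpa [hv₀] using hle v₀ hv₀V
      · rw [← h0]; exact hpos v₀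
    obtain ⟨a, -, ha, haA⟩ := exists_seq_tendsto_sSup hAne hAbd
    choose w hw hwa using haA
    obtain ⟨b, hb1, k, hk, hlim⟩ := exists_weakly_convergent_subseq w fun n => (hw n).2.le
    have hbV : b ∈ V := by
      rw [hVmem]
      intro f hf
      have h1 : ∀ n, ⟪w (k n), f⟫ = 0 := fun n => by
        rw [real_inner_comm]; exact (hVmem _).1 (hw (k n)).1 f hf
      have h2 := hlim f
      simp only [h1] at h2
      rw [real_inner_comm]
      exact (tendsto_nhds_unique h2 tendsto_const_nhds)
    have hTlim := hT (fun n => w (k n)) b (fun n => (hw _).2.le) hlim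
    have hQ : Tendsto (fun n => ⟪T (w (k n)), w (k n)⟫) atTop (𝓝 ⟪T b, b⟫) := by
      have h1 : Tendsto (fun n => ⟪T (w (k n)) - T b, w (k n)⟫) atTop (𝓝 0) := by
        have h3 : Tendsto (fun n => ‖T (w (k n)) - T b‖) atTop (𝓝 0) :=
          tendsto_iff_norm_sub_tendsto_zero.1 hTlim
        refine squeeze_zero_norm (fun n => ?_) h3
        refine (norm_inner_le_norm _ _).trans ?_
        rw [(hw _).2, mul_one]
      have h2 := h1.add (hlim (T b))
      rw [zero_add, real_inner_comm] at h2
      refine h2.congr fun n => ?_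
      rw [inner_sub_left, real_inner_comm (T b) (w (k n))]
      ring
    have hbs : ⟪T b, b⟫ = s := by
      refine tendsto_nhds_unique hQ ?_
      have : (fun n => ⟪T (w (k n)), w (k n)⟫) = a ∘ k := by
        ext n; exact hwa (k n)
      rw [this]
      exact ha.comp hk.tendsto_atTop
    refine ⟨b, hbV, le_antisymm hb1 ?_, hbs⟩
    have h1 := hle b hbV
    rw [hbs] at h1
    have h2 : 1 ≤ ‖b‖ ^ 2 := by
      by_contra! hlt
      nlinarith
    exact (one_le_sq_iff₀ (norm_nonneg _)).1 h2
  refine ⟨(v, s), hv1, (hVmem v).1 hvV, ?_, fun w hw => hle w ((hVmem w).2 hw)⟩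
  -- the form of `s - T` is nonnegative on `V` and vanishes at `v`
  set R : H →L[ℝ] H := s • ContinuousLinearMap.id ℝ H - T with hR
  have hRx : ∀ x, R x = s • x - T x := fun x => by simp [hR]
  have hRsym : ∀ x y, ⟪R x, y⟫ = ⟪x, R y⟫ := by
    intro x y
    simp only [hRx, inner_sub_left, inner_sub_right, inner_smul_left, inner_smul_right, hsym,
      RCLike.conj_to_real]
  have hRpos : ∀ x ∈ V, 0 ≤ ⟪R x, x⟫ := by
    intro x hx
    rw [hRx, inner_sub_left, inner_smul_left, real_inner_self_eq_norm_sq]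
    have := hle x hx
    simpa using this
  have hRv : ⟪R v, v⟫ = 0 := by
    rw [hRx, inner_sub_left, inner_smul_left, real_inner_self_eq_norm_sq, hvs, hv1]
    simp
  have hRV : R v ∈ V := by
    rw [hRx]; exact V.sub_mem (V.smul_mem _ hvV) (hTV v hvV)
  have h := form_eq_zero_of_isotropic hRsym hRpos hvV hRV hRv
  rw [inner_self_eq_zero, hRx, sub_eq_zero] at h
  exact h.symm

/-- `φ 0, φ 1, …` are orthonormal eigenvectors of `T`, with eigenvalues `lam 0 ≥ lam 1 ≥ … ≥ 0`,
and `T` vanishes on the orthogonal complement of all of them. -/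
structure IsSpectralSequence (T : H →L[ℝ] H) (lam : ℕ → ℝ) (φ : ℕ → H) : Prop where
  orthonormal : Orthonormal ℝ φ
  nonneg : ∀ i, 0 ≤ lam i
  antitone : Antitone lam
  eigen : ∀ i, T (φ i) = lam i • φ i
  ker : ∀ w, (∀ i, ⟪φ i, w⟫ = 0) → T w = 0

/-- The spectral theorem for a positive completely continuous operator on an infinite-dimensional
space. Choosing a maximal eigenvector of the orthogonal complement again and again yields the
sequence, also when only finitely many eigenvalues are nonzero. -/
theorem exists_isSpectralSequence [CompleteSpace H] [TopologicalSpace.SeparableSpace H]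
    (hfin : ¬ FiniteDimensional ℝ H) {T : H →L[ℝ] H}
    (hsym : ∀ x y, ⟪T x, y⟫ = ⟪x, T y⟫) (hpos : ∀ x, 0 ≤ ⟪T x, x⟫)
    (hT : IsCompletelyContinuous T) : ∃ lam φ, IsSpectralSequence T lam φ := by
  classical
  have hex := fun (S : Finset H) (hS : ∀ f ∈ S, ∃ c : ℝ, T f = c • f) =>
    exists_maximal_eigenvector hfin hsym hpos hT S hS
  choose! F hF1 hFS hFT hFmax using hex
  -- `S n` is the set of the first `n` eigenvectors, and `F (S n)` the next one with its eigenvalue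
  let S : ℕ → Finset H := fun n => Nat.rec ∅ (fun _ s => insert (F s).1 s) n
  have hSsucc : ∀ n, S (n + 1) = insert (F (S n)).1 (S n) := fun n => rfl
  have hgood : ∀ n, ∀ f ∈ S n, ∃ c : ℝ, T f = c • f := by
    intro n
    induction n with
    | zero => intro f hf; simp [S] at hf
    | succ n ih =>
      intro f hf
      rw [hSsucc, Finset.mem_insert] at hf
      rcases hf with rfl | hf
      · exact ⟨_, hFT _ ih⟩
      · exact ih f hf
  have hmono : Monotone S := monotone_nat_of_le_succ fun n => by
    rw [hSsucc]; exact Finset.subset_insert _ _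
  set φ : ℕ → H := fun n => (F (S n)).1 with hφ
  set lam : ℕ → ℝ := fun n => (F (S n)).2 with hlam
  have hmem : ∀ i j, i < j → φ i ∈ S j := by
    intro i j hij
    refine hmono (Nat.succ_le_of_lt hij) ?_
    rw [Nat.succ_eq_add_one, hSsucc]
    exact Finset.mem_insert_self _ _
  have hSφ : ∀ n, ∀ f ∈ S n, ∃ i, f = φ i := by
    intro n
    induction n with
    | zero => intro f hf; simp [S] at hf
    | succ n ih =>
      intro f hf
      rw [hSsucc, Finset.mem_insert] at hf
      rcases hf with rfl | hf
      · exact ⟨n, rfl⟩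
      · exact ih f hf
  have horth : Orthonormal ℝ φ := by
    refine ⟨fun n => hF1 _ (hgood n), fun i j hij => ?_⟩
    rcases lt_or_gt_of_ne hij with h | h
    · exact hFS _ (hgood j) _ (hmem i j h)
    · rw [real_inner_comm]; exact hFS _ (hgood i) _ (hmem j i h)
  have hTφ : ∀ n, T (φ n) = lam n • φ n := fun n => hFT _ (hgood n)
  have hlamQ : ∀ n, ⟪T (φ n), φ n⟫ = lam n := by
    intro n
    rw [hTφ, inner_smul_left, real_inner_self_eq_norm_sq, horth.1 n]
    simp
  have hnonneg : ∀ n, 0 ≤ lam n := fun n => by rw [← hlamQ]; exact hpos _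
  -- an orthonormal sequence tends weakly to zero, so the eigenvalues tend to zero
  have hlim : Tendsto lam atTop (𝓝 0) := by
    have hweak : ∀ v, Tendsto (fun n => ⟪φ n, v⟫) atTop (𝓝 ⟪(0 : H), v⟫) := by
      intro v
      rw [inner_zero_left]
      have h1 := (horth.inner_products_summable v).tendsto_atTop_zero
      refine squeeze_zero_norm (fun n => le_rfl) ?_
      simpa [Real.sqrt_sq_eq_abs] using h1.sqrt
    have h1 := hT φ 0 (fun n => (horth.1 n).le) hweak
    have h2 := h1.norm
    rw [map_zero, norm_zero] at h2
    refine h2.congr fun n => ?_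
    rw [hTφ, norm_smul, horth.1 n, mul_one, Real.norm_of_nonneg (hnonneg n)]
  refine ⟨lam, φ, horth, hnonneg, antitone_nat_of_succ_le fun n => ?_, hTφ, fun w hw => ?_⟩
  · rw [← hlamQ (n + 1)]
    have h1 := hFmax (S n) (hgood n) (φ (n + 1)) fun f hf =>
      hFS _ (hgood (n + 1)) f (hmono n.le_succ hf)
    have h2 : ‖φ (n + 1)‖ = 1 := horth.1 (n + 1)
    simpa [h2] using h1
  · have h1 : ∀ n, ⟪T w, w⟫ ≤ lam n * ‖w‖ ^ 2 := fun n =>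
      hFmax (S n) (hgood n) w fun f hf => by
        obtain ⟨i, rfl⟩ := hSφ n f hf
        exact hw i
    have h2 : Tendsto (fun n => lam n * ‖w‖ ^ 2) atTop (𝓝 0) := by
      simpa using hlim.mul_const (‖w‖ ^ 2)
    have h3 : ⟪T w, w⟫ = 0 := le_antisymm (ge_of_tendsto' h2 h1) (hpos w)
    have h4 := form_eq_zero_of_isotropic (V := ⊤) hsym (fun x _ => hpos x)
      (Submodule.mem_top (x := w)) (Submodule.mem_top (x := T w)) h3
    exact inner_self_eq_zero.1 h4

/-- The spectral decomposition of the bilinear form of `T`. -/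
lemma IsSpectralSequence.hasSum_inner [CompleteSpace H] {T : H →L[ℝ] H} {lam : ℕ → ℝ} {φ : ℕ → H}
    (hd : IsSpectralSequence T lam φ) (hsym : ∀ x y, ⟪T x, y⟫ = ⟪x, T y⟫) (v w : H) :
    HasSum (fun i => lam i * (⟪φ i, v⟫ * ⟪φ i, w⟫)) ⟪T v, w⟫ := by
  have h := hasSum_inner_mul_inner_of_orthonormal hd.orthonormal (v := T v)
    (fun h hh => by rw [hsym, hd.ker h hh, inner_zero_right]) w
  refine h.congr_fun fun i => ?_
  rw [← hsym, hd.eigen, inner_smul_left]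
  simp [mul_assoc]

/-- A nonzero eigenvalue occurs in the sequence: otherwise the eigenvector would be orthogonal to
all `φ i`. -/
lemma IsSpectralSequence.exists_eq_of_eigenvector {T : H →L[ℝ] H} {lam : ℕ → ℝ} {φ : ℕ → H}
    (hd : IsSpectralSequence T lam φ) (hsym : ∀ x y, ⟪T x, y⟫ = ⟪x, T y⟫) {c : ℝ} (hc : c ≠ 0)
    {f : H} (hf : f ≠ 0) (hTf : T f = c • f) : ∃ i, lam i = c := by
  by_contra! hne
  refine hf ?_
  have h : T f = 0 := hd.ker f fun i => by
    have h1 := hsym (φ i) f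
    rw [hd.eigen, hTf, inner_smul_left, inner_smul_right, RCLike.conj_to_real] at h1
    have h2 : (lam i - c) * ⟪φ i, f⟫ = 0 := by linarith
    exact (mul_eq_zero.1 h2).resolve_left (sub_ne_zero.2 (hne i))
  rw [hTf] at h
  exact (smul_eq_zero.1 h).resolve_left hc

-- `Gs` is the adjoint of `G`, given by its defining property in the lemmas below
variable {G : H' →L[ℝ] H} {Gs : H →L[ℝ] H'}

lemma adjoint_symm (hadj : ∀ x y, ⟪G x, y⟫ = ⟪x, Gs y⟫) (x : H) (y : H') :
    ⟪Gs x, y⟫ = ⟪x, G y⟫ := by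
  rw [real_inner_comm, ← hadj, real_inner_comm]

lemma inner_comp_adjoint (hadj : ∀ x y, ⟪G x, y⟫ = ⟪x, Gs y⟫) (x y : H) :
    ⟪(G ∘L Gs) x, y⟫ = ⟪Gs x, Gs y⟫ := by
  rw [ContinuousLinearMap.comp_apply, hadj]

lemma isSymmetric_comp_adjoint (hadj : ∀ x y, ⟪G x, y⟫ = ⟪x, Gs y⟫) (x y : H) :
    ⟪(G ∘L Gs) x, y⟫ = ⟪x, (G ∘L Gs) y⟫ := by
  rw [inner_comp_adjoint hadj, real_inner_comm, ← inner_comp_adjoint hadj, real_inner_comm]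

/-- One half of the equality of the spectra of `G G*` and `G* G`, by the Courant–Fischer argument:
the span of `ψ 0, …, ψ n` contains a nonzero vector `v` for which `G v` is orthogonal to
`φ 0, …, φ (n - 1)`, and the quadratic form of `G G*` at `G v` is compared with both eigenvalues. -/
lemma IsSpectralSequence.le_of_adjoint [CompleteSpace H] (hadj : ∀ x y, ⟪G x, y⟫ = ⟪x, Gs y⟫)
    {lam lam' : ℕ → ℝ} {φ : ℕ → H} {ψ : ℕ → H'} (hd : IsSpectralSequence (G ∘L Gs) lam φ)
    (hd' : IsSpectralSequence (Gs ∘L G) lam' ψ) (n : ℕ) : lam' n ≤ lam n := by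
  rcases (hd'.nonneg n).eq_or_lt with h0 | hpos
  · rw [← h0]; exact hd.nonneg n
  -- a nonzero combination `v` of `ψ 0, …, ψ n` with `G v` orthogonal to `φ 0, …, φ (n - 1)`
  obtain ⟨c, hc, hc0⟩ : ∃ c : Fin (n + 1) → ℝ,
      (∀ j : Fin n, ⟪φ j, G (∑ i, c i • ψ i)⟫ = 0) ∧ c ≠ 0 := by
    let L : (Fin (n + 1) → ℝ) →ₗ[ℝ] (Fin n → ℝ) :=
      { toFun := fun c j => ⟪φ j, G (∑ i, c i • ψ i)⟫
        map_add' := fun a b => by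
          ext j; simp [add_smul, Finset.sum_add_distrib, inner_add_right]
        map_smul' := fun r a => by
          ext j; simp [mul_smul, ← Finset.smul_sum, inner_smul_right] }
    have hk : LinearMap.ker L ≠ ⊥ := LinearMap.ker_ne_bot_of_finrank_lt (by simp)
    obtain ⟨c, hcL, hc0⟩ := (LinearMap.ker L).ne_bot_iff.1 hk
    exact ⟨c, fun j => congrFun (LinearMap.mem_ker.1 hcL) j, hc0⟩
  set v : H' := ∑ i, c i • ψ i with hv
  have hψ : Orthonormal ℝ fun i : Fin (n + 1) => ψ i :=
    hd'.orthonormal.comp _ Fin.val_injective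
  have hTv : Gs (G v) = ∑ i : Fin (n + 1), (lam' i * c i) • ψ i := by
    rw [hv, map_sum, map_sum]
    refine Finset.sum_congr rfl fun i _ => ?_
    have := hd'.eigen i
    rw [ContinuousLinearMap.comp_apply] at this
    rw [map_smul, map_smul, this, smul_smul, mul_comm]
  have hGv : ‖G v‖ ^ 2 = ∑ i : Fin (n + 1), lam' i * c i ^ 2 := by
    rw [← real_inner_self_eq_norm_sq, hadj, hTv, hv, hψ.inner_sum]
    refine Finset.sum_congr rfl fun i _ => ?_
    simp; ring
  have hGsGv : ‖Gs (G v)‖ ^ 2 = ∑ i : Fin (n + 1), lam' i ^ 2 * c i ^ 2 := by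
    rw [← real_inner_self_eq_norm_sq, hTv, hψ.inner_sum]
    refine Finset.sum_congr rfl fun i _ => ?_
    simp; ring
  have hi : ∀ i : Fin (n + 1), lam' n ≤ lam' i := fun i => hd'.antitone (Nat.le_of_lt_succ i.2)
  have hlower : lam' n * ‖G v‖ ^ 2 ≤ ‖Gs (G v)‖ ^ 2 := by
    rw [hGv, hGsGv, Finset.mul_sum]
    refine Finset.sum_le_sum fun i _ => ?_
    nlinarith [mul_le_mul_of_nonneg_right (hi i)
      (mul_nonneg (hd'.nonneg i) (sq_nonneg (c i)))]
  have hGv0 : 0 < ‖G v‖ ^ 2 := by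
    obtain ⟨j, hj⟩ := Function.ne_iff.1 hc0
    rw [hGv]
    refine Finset.sum_pos' (fun i _ => mul_nonneg (hd'.nonneg i) (sq_nonneg _))
      ⟨j, Finset.mem_univ _, mul_pos (hpos.trans_le (hi j)) (sq_pos_of_ne_zero hj)⟩
  have hupper : ‖Gs (G v)‖ ^ 2 ≤ lam n * ‖G v‖ ^ 2 := by
    have h1 := hd.hasSum_inner (isSymmetric_comp_adjoint hadj) (G v) (G v)
    rw [ContinuousLinearMap.comp_apply, hadj, real_inner_self_eq_norm_sq] at h1
    have h2 : Summable fun i => lam n * ‖⟪φ i, G v⟫‖ ^ 2 :=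
      (hd.orthonormal.inner_products_summable (G v)).mul_left _
    have h3 : ‖Gs (G v)‖ ^ 2 ≤ ∑' i, lam n * ‖⟪φ i, G v⟫‖ ^ 2 := by
      rw [← h1.tsum_eq]
      refine h1.summable.tsum_le_tsum (fun i => ?_) h2
      rw [Real.norm_eq_abs, sq_abs, ← sq]
      rcases lt_or_ge i n with hin | hin
      · simp [hc ⟨i, hin⟩]
      · exact mul_le_mul_of_nonneg_right (hd.antitone hin) (sq_nonneg _)
    rw [tsum_mul_left] at h3
    exact h3.trans (mul_le_mul_of_nonneg_left (hd.orthonormal.tsum_inner_products_le (G v))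
      (hd.nonneg n))
  exact le_of_mul_le_mul_right (hlower.trans hupper) hGv0

/-- `G G*` and `G* G` have the same eigenvalue sequence. -/
lemma IsSpectralSequence.eq_of_adjoint [CompleteSpace H] [CompleteSpace H']
    (hadj : ∀ x y, ⟪G x, y⟫ = ⟪x, Gs y⟫)
    {lam lam' : ℕ → ℝ} {φ : ℕ → H} {ψ : ℕ → H'} (hd : IsSpectralSequence (G ∘L Gs) lam φ)
    (hd' : IsSpectralSequence (Gs ∘L G) lam' ψ) : lam' = lam :=
  funext fun n => le_antisymm (hd.le_of_adjoint hadj hd' n)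
    (hd'.le_of_adjoint (adjoint_symm hadj) hd n)

/-- Parseval's identity for the orthonormal family `lam i ^ (-1/2) • G* (φ i)`, `lam i ≠ 0`, which
spans the orthogonal complement of the kernel of `G`. The terms with `lam i = 0` vanish. -/
lemma IsSpectralSequence.hasSum_inner_adjoint [CompleteSpace H']
    (hadj : ∀ x y, ⟪G x, y⟫ = ⟪x, Gs y⟫)
    {lam : ℕ → ℝ} {φ : ℕ → H} (hd : IsSpectralSequence (G ∘L Gs) lam φ) {v : H'}
    (hv : ∀ h, G h = 0 → ⟪v, h⟫ = 0) (w : H') :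
    HasSum (fun i => (lam i)⁻¹ * (⟪Gs (φ i), v⟫ * ⟪Gs (φ i), w⟫)) ⟪v, w⟫ := by
  have hinner : ∀ i j, ⟪Gs (φ i), Gs (φ j)⟫ = if i = j then lam i else 0 := by
    intro i j
    rw [← inner_comp_adjoint hadj, hd.eigen, inner_smul_left,
      orthonormal_iff_ite.1 hd.orthonormal]
    split_ifs <;> simp
  let e : {i // lam i ≠ 0} → H' := fun i => (√(lam i))⁻¹ • Gs (φ i)
  have hlt : ∀ i : {i // lam i ≠ 0}, 0 < lam i := fun i => (hd.nonneg i).lt_of_ne' i.2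
  have he : Orthonormal ℝ e := by
    classical
    rw [orthonormal_iff_ite]
    intro i j
    simp only [e, inner_smul_left, inner_smul_right, hinner, RCLike.conj_to_real]
    by_cases hij : i = j
    · subst hij
      have h1 := Real.mul_self_sqrt (hlt i).le
      have h2 := (Real.sqrt_pos.2 (hlt i)).ne'
      simp only [if_true]
      field_simp
      nlinarith
    · rw [if_neg hij, if_neg fun h => hij (Subtype.ext h)]
      simp
  have hperp : ∀ h, (∀ i, ⟪e i, h⟫ = 0) → ⟪v, h⟫ = 0 := by
    intro h hh
    refine hv h ?_
    have h1 : (G ∘L Gs) (G h) = 0 := hd.ker _ fun i => by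
      rw [← adjoint_symm hadj]
      by_cases hi : lam i = 0
      · have h2 : Gs (φ i) = 0 := by
          rw [← inner_self_eq_zero (𝕜 := ℝ), hinner, if_pos rfl, hi]
        rw [h2, inner_zero_left]
      · have h2 := hh ⟨i, hi⟩
        simp only [e, inner_smul_left, RCLike.conj_to_real] at h2
        exact (mul_eq_zero.1 h2).resolve_left
          (inv_ne_zero (Real.sqrt_pos.2 (hlt ⟨i, hi⟩)).ne')
    have h2 : Gs (G h) = 0 := by
      rw [← inner_self_eq_zero (𝕜 := ℝ), ← inner_comp_adjoint hadj, h1, inner_zero_left]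
    rw [← inner_self_eq_zero (𝕜 := ℝ), hadj, h2, inner_zero_right]
  have h := hasSum_inner_mul_inner_of_orthonormal he hperp w
  refine (Subtype.val_injective.hasSum_iff (fun i hi => ?_)).1 (h.congr_fun fun i => ?_)
  · have : lam i = 0 := by
      by_contra h0
      exact hi ⟨⟨i, h0⟩, rfl⟩
    simp [this]
  · simp only [e, inner_smul_left, RCLike.conj_to_real, Function.comp_apply]
    have h1 := Real.mul_self_sqrt (hlt i).le
    have h2 : (lam i)⁻¹ = (√(lam i))⁻¹ * (√(lam i))⁻¹ := by rw [← mul_inv, h1]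
    rw [h2]; ring

variable {s : H} {s' : H'}

/-- The eigenvalue `1` of the vector `s` is the largest one because `G*` is a contraction. -/
lemma IsSpectralSequence.lam_zero_eq_one (hadj : ∀ x y, ⟪G x, y⟫ = ⟪x, Gs y⟫)
    {lam : ℕ → ℝ} {φ : ℕ → H} (hd : IsSpectralSequence (G ∘L Gs) lam φ)
    (hnorm : ∀ f, ‖Gs f‖ ≤ ‖f‖) (hs : ‖s‖ = 1) (hGs' : G s' = s) (hGss : Gs s = s') :
    lam 0 = 1 := by
  have hle : lam 0 ≤ 1 := by
    have h1 := inner_comp_adjoint hadj (φ 0) (φ 0)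
    rw [hd.eigen, inner_smul_left, real_inner_self_eq_norm_sq, real_inner_self_eq_norm_sq,
      hd.orthonormal.1 0] at h1
    have h2 := hnorm (φ 0)
    rw [hd.orthonormal.1 0] at h2
    simp only [RCLike.conj_to_real, one_pow, mul_one] at h1
    rw [h1]
    exact pow_le_one₀ (norm_nonneg _) h2
  obtain ⟨i, hi⟩ := hd.exists_eq_of_eigenvector (isSymmetric_comp_adjoint hadj) one_ne_zero
    (f := s) (fun h => by simp [h] at hs) (by simp [hGss, hGs'])
  exact le_antisymm hle (hi ▸ hd.antitone (Nat.zero_le i))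

/-- For an operator with range in the span of `s`, the vector `φ 0` is a multiple of `s`, so that
the other `φ i`, being orthogonal to it, are mapped to zero. -/
lemma IsSpectralSequence.lam_eq_zero_of_rank_one {T : H →L[ℝ] H} {lam : ℕ → ℝ} {φ : ℕ → H}
    (hd : IsSpectralSequence T lam φ) (h0 : lam 0 = 1) (hT : ∀ f, T f = ⟪s, f⟫ • s)
    {i : ℕ} (hi : 1 ≤ i) : lam i = 0 := by
  have h1 : φ 0 = ⟪s, φ 0⟫ • s := by rw [← hT, hd.eigen, h0, one_smul]
  have h2 : ⟪s, φ 0⟫ ≠ 0 := fun h => by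
    rw [h, zero_smul] at h1
    exact hd.orthonormal.ne_zero 0 h1
  have h3 : ⟪φ 0, φ i⟫ = 0 := hd.orthonormal.2 (by lia)
  rw [h1, inner_smul_left] at h3
  have h4 := (mul_eq_zero.1 h3).resolve_left (by simpa using h2)
  have h5 := hd.eigen i
  rw [hT, h4, zero_smul] at h5
  exact (smul_eq_zero.1 h5.symm).resolve_right (hd.orthonormal.ne_zero i)

/-- If `G G*` has only one nonzero eigenvalue, and `G` and `G*` exchange the unit vectors `s` and
`s'`, then `G` is the rank one operator given by `s` and `s'`. -/
lemma IsSpectralSequence.inner_eq_of_lam_eq_zero [CompleteSpace H]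
    (hadj : ∀ x y, ⟪G x, y⟫ = ⟪x, Gs y⟫)
    {lam : ℕ → ℝ} {φ : ℕ → H} (hd : IsSpectralSequence (G ∘L Gs) lam φ) (h0 : lam 0 = 1)
    (hlam : ∀ i, 1 ≤ i → lam i = 0) (hs : ‖s‖ = 1) (hGs' : G s' = s) (hGss : Gs s = s')
    (k : H') (h : H) : ⟪G k, h⟫ = ⟪s, h⟫ * ⟪s', k⟫ := by
  have hTform : ∀ f w, ⟪(G ∘L Gs) f, w⟫ = ⟪φ 0, f⟫ * ⟪φ 0, w⟫ := by
    intro f w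
    have h1 := hd.hasSum_inner (isSymmetric_comp_adjoint hadj) f w
    have h2 := hasSum_single (f := fun i => lam i * (⟪φ i, f⟫ * ⟪φ i, w⟫)) 0
      (fun i hi => by simp [hlam i (Nat.one_le_iff_ne_zero.2 hi)])
    rw [h1.unique h2, h0, one_mul]
  have hperp : ∀ f, ⟪s, f⟫ = 0 → Gs f = 0 := by
    intro f hf
    have hTs : (G ∘L Gs) s = s := by simp [hGss, hGs']
    have h1 := hTform s f
    have h2 := hTform s s
    rw [hTs, hf] at h1
    rw [hTs, real_inner_self_eq_norm_sq, hs] at h2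
    have h3 : ⟪φ 0, f⟫ = 0 := by
      refine (mul_eq_zero.1 h1.symm).resolve_left fun h => ?_
      rw [h] at h2
      norm_num at h2
    rw [← inner_self_eq_zero (𝕜 := ℝ), ← inner_comp_adjoint hadj, hTform, h3, zero_mul]
  have hGs : Gs h = ⟪s, h⟫ • s' := by
    have h1 := hperp (h - ⟪s, h⟫ • s) (by
      rw [inner_sub_right, inner_smul_right, real_inner_self_eq_norm_sq, hs]; ring)
    rw [map_sub, map_smul, hGss, sub_eq_zero] at h1
    exact h1
  rw [hadj, hGs, inner_smul_right, real_inner_comm k]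

end Hilbert

/-! ### Integral operators with a contractive kernel -/

section General

variable {α : Type*} [MeasurableSpace α] {μ : Measure α}

/-- The Cauchy–Schwarz inequality for lower Lebesgue integrals. -/
lemma sq_lintegral_mul_le {f h : α → ℝ≥0∞} (hf : AEMeasurable f μ) (hh : AEMeasurable h μ) :
    (∫⁻ x, f x * h x ∂μ) ^ 2 ≤ (∫⁻ x, f x ^ 2 ∂μ) * ∫⁻ x, h x ^ 2 ∂μ := by
  have h1 := ENNReal.lintegral_mul_le_Lp_mul_Lq μ Real.HolderConjugate.two_two hf hh
  have h2 := pow_le_pow_left' h1 2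
  refine h2.trans_eq ?_
  simp only [ENNReal.rpow_two]
  rw [mul_pow, ← ENNReal.rpow_two, ← ENNReal.rpow_two, ← ENNReal.rpow_mul, ← ENNReal.rpow_mul]
  norm_num

lemma eLpNorm_two_sq (f : α → ℝ) : eLpNorm f 2 μ ^ 2 = ∫⁻ x, ‖f x‖ₑ ^ 2 ∂μ := by
  have h := eLpNorm_nnreal_pow_eq_lintegral (f := f) (μ := μ) (p := 2) two_ne_zero
  simpa using h

lemma memLp_two_of_lintegral {f : α → ℝ} (hf : AEStronglyMeasurable f μ)
    (h : ∫⁻ x, ‖f x‖ₑ ^ 2 ∂μ ≠ ∞) : MemLp f 2 μ := by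
  refine ⟨hf, ?_⟩
  rw [← eLpNorm_two_sq] at h
  exact lt_top_iff_ne_top.2 fun h' => h (by simp [h'])

lemma tendsto_zero_of_sq {ι : Type*} {l : Filter ι} {f : ι → ℝ≥0∞}
    (h : Tendsto (fun i => f i ^ 2) l (𝓝 0)) : Tendsto f l (𝓝 0) := by
  have h1 := (ENNReal.continuous_rpow_const (y := 1 / 2)).tendsto 0 |>.comp h
  rw [ENNReal.zero_rpow_of_pos (by norm_num)] at h1
  refine h1.congr fun i => ?_
  rw [Function.comp_apply, ← ENNReal.rpow_two, ← ENNReal.rpow_mul]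
  norm_num

lemma enorm_Lp_sq (f : Lp ℝ 2 μ) : ‖f‖ₑ ^ 2 = ∫⁻ x, ‖f x‖ₑ ^ 2 ∂μ := by
  rw [Lp.enorm_def, eLpNorm_two_sq]

lemma inner_Lp (f h : Lp ℝ 2 μ) : ⟪f, h⟫ = ∫ x, f x * h x ∂μ := by
  rw [L2.inner_def]
  refine integral_congr_ae (ae_of_all _ fun x => ?_)
  simp [mul_comm]

/-- If every vector of `S` is orthogonal to `v x` for almost every `x`, the exceptional null set
can be chosen independently of the vector. -/
lemma ae_forall_inner_eq_zero {H : Type*} [NormedAddCommGroup H] [InnerProductSpace ℝ H]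
    [SecondCountableTopology H] (v : α → H) (S : Set H)
    (h : ∀ w ∈ S, ∀ᵐ x ∂μ, ⟪v x, w⟫ = 0) : ∀ᵐ x ∂μ, ∀ w ∈ S, ⟪v x, w⟫ = 0 := by
  obtain ⟨D, hDc, hDd⟩ := TopologicalSpace.exists_countable_dense S
  have h1 : ∀ᵐ x ∂μ, ∀ w ∈ D, ⟪v x, (w : H)⟫ = 0 :=
    (ae_ball_iff hDc).2 fun w _ => h w w.2
  filter_upwards [h1] with x hx w hw
  have hcl : IsClosed {w : S | ⟪v x, (w : H)⟫ = 0} :=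
    isClosed_eq (by fun_prop) continuous_const
  have h2 : closure D ⊆ {w : S | ⟪v x, (w : H)⟫ = 0} := hcl.closure_subset_iff.2 hx
  exact h2 (hDd ⟨w, hw⟩)

end General

section Operator

variable {α β : Type*} [MeasureSpace α] [MeasureSpace β]

/-- A nonnegative kernel whose integral operators, in both directions, are contractions of `L²`.
The bound is stated for nonnegative functions, which yields absolute convergence as well. -/
structure IsContractiveKernel (g : α → β → ℝ≥0) : Prop where
  measurable : Measurable fun z : α × β => g z.1 z.2
  bound : ∀ h : β → ℝ≥0∞, Measurable h → ∫⁻ x, (∫⁻ u, g x u * h u) ^ 2 ≤ ∫⁻ u, h u ^ 2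
  bound_swap : ∀ h : α → ℝ≥0∞, Measurable h → ∫⁻ u, (∫⁻ x, g x u * h x) ^ 2 ≤ ∫⁻ x, h x ^ 2

/-- The kernel of `G G*`, where `G` is the integral operator with kernel `g`. -/
noncomputable def gramKernel (g : α → β → ℝ≥0) (x x' : α) : ℝ≥0∞ :=
  ∫⁻ u, (g x u : ℝ≥0∞) * g x' u

namespace IsContractiveKernel

variable {g : α → β → ℝ≥0} (hg : IsContractiveKernel g)

include hg

lemma swap : IsContractiveKernel (Function.swap g) where
  measurable := hg.measurable.comp measurable_swap
  bound := hg.bound_swap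
  bound_swap := hg.bound

lemma measurable_row (x : α) : Measurable (g x) :=
  hg.measurable.comp (by fun_prop : Measurable fun u : β => (x, u))

lemma measurable_comp {γ : Type*} [MeasurableSpace γ] {a : γ → α} {b : γ → β}
    (ha : Measurable a) (hb : Measurable b) : Measurable fun c => (g (a c) (b c) : ℝ≥0∞) :=
  (hg.measurable.comp (ha.prodMk hb)).coe_nnreal_ennreal

lemma measurable_coe : Measurable fun z : α × β => (g z.1 z.2 : ℝ) :=
  hg.measurable.coe_nnreal_real

lemma lintegral_integral_sq_le (f : Lp ℝ 2 (volume : Measure β)) :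
    ∫⁻ x, ‖∫ u, (g x u : ℝ) * f u‖ₑ ^ 2 ≤ ‖f‖ₑ ^ 2 := by
  rw [enorm_Lp_sq]
  refine le_trans ?_ (hg.bound _ (Lp.stronglyMeasurable f).measurable.enorm)
  refine lintegral_mono fun x => pow_le_pow_left' ?_ 2
  refine (enorm_integral_le_lintegral_enorm _).trans_eq ?_
  simp [enorm_mul]

variable [SigmaFinite (volume : Measure β)]

lemma measurable_gramKernel : Measurable fun z : α × α => gramKernel g z.1 z.2 := by
  have h : Measurable fun z : (α × α) × β => (g z.1.1 z.2 * g z.1.2 z.2 : ℝ≥0∞) :=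
    (hg.measurable_comp (by fun_prop) (by fun_prop)).mul
      (hg.measurable_comp (by fun_prop) (by fun_prop))
  exact h.lintegral_prod_right'

lemma measurable_lintegral_mul {h : β → ℝ≥0∞} (hh : Measurable h) :
    Measurable fun x => ∫⁻ u, g x u * h u :=
  (hg.measurable.coe_nnreal_ennreal.mul (hh.comp measurable_snd)).lintegral_prod_right'

/-- The defining integral of the operator converges absolutely, almost everywhere. -/
lemma ae_lintegral_lt_top {h : β → ℝ≥0∞} (hh : Measurable h) (hfin : ∫⁻ u, h u ^ 2 ≠ ∞) :
    ∀ᵐ x, ∫⁻ u, g x u * h u < ∞ := by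
  have h1 := ae_lt_top ((hg.measurable_lintegral_mul hh).pow_const 2)
    (ne_top_of_le_ne_top hfin (hg.bound _ hh))
  filter_upwards [h1] with x hx
  by_contra hcon
  rw [not_lt, top_le_iff] at hcon
  simp [hcon] at hx

lemma ae_integrable (f : Lp ℝ 2 (volume : Measure β)) :
    ∀ᵐ x, Integrable fun u => (g x u : ℝ) * f u := by
  have hm : Measurable fun u => ‖f u‖ₑ := (Lp.stronglyMeasurable f).measurable.enorm
  filter_upwards [hg.ae_lintegral_lt_top hm (by rw [← enorm_Lp_sq]; simp)] with x hx
  refine ⟨((hg.measurable_row x).coe_nnreal_real.mul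
    (Lp.stronglyMeasurable f).measurable).aestronglyMeasurable, ?_⟩
  rw [HasFiniteIntegral]
  simpa [enorm_mul] using hx

lemma measurable_integral (f : Lp ℝ 2 (volume : Measure β)) :
    Measurable fun x => ∫ u, (g x u : ℝ) * f u := by
  have : StronglyMeasurable fun z : α × β => (g z.1 z.2 : ℝ) * f z.2 :=
    (hg.measurable_coe.mul ((Lp.stronglyMeasurable f).measurable.comp
      measurable_snd)).stronglyMeasurable
  exact this.integral_prod_right.measurable

lemma memLp_integral (f : Lp ℝ 2 (volume : Measure β)) :
    MemLp (fun x => ∫ u, (g x u : ℝ) * f u) 2 :=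
  memLp_two_of_lintegral (hg.measurable_integral f).aestronglyMeasurable
    (ne_top_of_le_ne_top (by simp) (hg.lintegral_integral_sq_le f))

lemma norm_toLp_integral_le (f : Lp ℝ 2 (volume : Measure β)) :
    ‖(hg.memLp_integral f).toLp _‖ ≤ ‖f‖ := by
  have h1 : ‖(hg.memLp_integral f).toLp _‖ₑ ^ 2 ≤ ‖f‖ₑ ^ 2 := by
    refine le_trans (le_of_eq ?_) (hg.lintegral_integral_sq_le f)
    rw [Lp.enorm_toLp, eLpNorm_two_sq]
  have h2 : ‖(hg.memLp_integral f).toLp _‖ₑ ≤ ‖f‖ₑ :=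
    (ENNReal.pow_le_pow_left_iff two_ne_zero).1 h1
  exact enorm_le_iff_norm_le.1 h2

/-- The integral operator with kernel `g`, as a bounded operator on `L²`. -/
noncomputable def op : Lp ℝ 2 (volume : Measure β) →L[ℝ] Lp ℝ 2 (volume : Measure α) :=
  LinearMap.mkContinuous
    { toFun := fun f => (hg.memLp_integral f).toLp _
      map_add' := fun f h => by
        refine Lp.ext ?_
        filter_upwards [(hg.memLp_integral (f + h)).coeFn_toLp, Lp.coeFn_add
          ((hg.memLp_integral f).toLp _) ((hg.memLp_integral h).toLp _),
          (hg.memLp_integral f).coeFn_toLp, (hg.memLp_integral h).coeFn_toLp,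
          hg.ae_integrable f, hg.ae_integrable h] with x h1 h2 h3 h4 h5 h6
        rw [h1, h2, Pi.add_apply, h3, h4, ← integral_add h5 h6]
        refine integral_congr_ae ?_
        filter_upwards [Lp.coeFn_add f h] with u hu
        rw [hu, Pi.add_apply, mul_add]
      map_smul' := fun c f => by
        refine Lp.ext ?_
        filter_upwards [(hg.memLp_integral (c • f)).coeFn_toLp, Lp.coeFn_smul c
          ((hg.memLp_integral f).toLp _), (hg.memLp_integral f).coeFn_toLp] with x h1 h2 h3
        rw [h1, RingHom.id_apply, h2, Pi.smul_apply, h3, smul_eq_mul, ← integral_const_mul]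
        refine integral_congr_ae ?_
        filter_upwards [Lp.coeFn_smul c f] with u hu
        rw [hu, Pi.smul_apply, smul_eq_mul]
        ring } 1 fun f => by
    rw [one_mul]
    exact hg.norm_toLp_integral_le f

lemma op_ae (f : Lp ℝ 2 (volume : Measure β)) :
    hg.op f =ᵐ[volume] fun x => ∫ u, (g x u : ℝ) * f u :=
  (hg.memLp_integral f).coeFn_toLp

lemma norm_op_le (f : Lp ℝ 2 (volume : Measure β)) : ‖hg.op f‖ ≤ ‖f‖ :=
  hg.norm_toLp_integral_le f

lemma integrable_mul_mul (f : Lp ℝ 2 (volume : Measure β)) (h : Lp ℝ 2 (volume : Measure α)) :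
    Integrable (Function.uncurry fun x u => (g x u : ℝ) * f u * h x)
      ((volume : Measure α).prod (volume : Measure β)) := by
  have hfm := (Lp.stronglyMeasurable f).measurable
  have hhm := (Lp.stronglyMeasurable h).measurable
  have hm : Measurable fun z : α × β => (g z.1 z.2 : ℝ) * f z.2 * h z.1 :=
    (hg.measurable_coe.mul (hfm.comp measurable_snd)).mul (hhm.comp measurable_fst)
  refine ⟨hm.aestronglyMeasurable, ?_⟩
  have h1 : (∫⁻ z : α × β, ‖(g z.1 z.2 : ℝ) * f z.2 * h z.1‖ₑ ∂((volume : Measure α).prod volume))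
      = ∫⁻ x, (∫⁻ u, g x u * ‖f u‖ₑ) * ‖h x‖ₑ := by
    rw [lintegral_prod _ hm.enorm.aemeasurable]
    refine lintegral_congr fun x => ?_
    simp only [enorm_mul, NNReal.enorm_eq]
    rw [lintegral_mul_const]
    exact (hg.measurable_row x).coe_nnreal_ennreal.mul hfm.enorm
  have h2 : (∫⁻ x, (∫⁻ u, g x u * ‖f u‖ₑ) * ‖h x‖ₑ) ^ 2 < ∞ := by
    refine (sq_lintegral_mul_le (hg.measurable_lintegral_mul hfm.enorm).aemeasurable
      hhm.enorm.aemeasurable).trans_lt (ENNReal.mul_lt_top ?_ ?_)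
    · refine (hg.bound _ hfm.enorm).trans_lt ?_
      rw [← enorm_Lp_sq]
      simp
    · rw [← enorm_Lp_sq]
      simp
  rw [← h1] at h2
  refine lt_top_iff_ne_top.2 fun hcon => ?_
  rw [show (∫⁻ z : α × β, ‖(g z.1 z.2 : ℝ) * f z.2 * h z.1‖ₑ
    ∂((volume : Measure α).prod volume)) = ∞ from hcon] at h2
  simp at h2

variable [SigmaFinite (volume : Measure α)]

/-- The integral operator with the transposed kernel is the adjoint. -/
lemma inner_op (f : Lp ℝ 2 (volume : Measure β)) (h : Lp ℝ 2 (volume : Measure α)) :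
    ⟪hg.op f, h⟫ = ⟪f, hg.swap.op h⟫ := by
  calc ⟪hg.op f, h⟫ = ∫ x, ∫ u, (g x u : ℝ) * f u * h x := by
        rw [inner_Lp]
        refine integral_congr_ae ?_
        filter_upwards [hg.op_ae f] with x hx
        rw [hx, integral_mul_const]
    _ = ∫ u, ∫ x, (g x u : ℝ) * f u * h x := integral_integral_swap (hg.integrable_mul_mul f h)
    _ = ⟪f, hg.swap.op h⟫ := by
        rw [inner_Lp]
        refine integral_congr_ae ?_
        filter_upwards [hg.swap.op_ae h] with u hu
        rw [hu, ← integral_const_mul]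
        congr 1
        ext x
        simp only [Function.swap]
        ring

/-- The composition of the operator of `g` with its adjoint. -/
noncomputable abbrev gramOp : Lp ℝ 2 (volume : Measure α) →L[ℝ] Lp ℝ 2 (volume : Measure α) :=
  hg.op ∘L hg.swap.op

/-- `gramOp` is the integral operator with kernel `gramKernel g`, by Fubini's theorem. For
almost every `x`, the kernel is finite at almost all points where `f` does not vanish, so that its
replacement of `∞` by `0` does not matter. -/
lemma gramOp_ae (f : Lp ℝ 2 (volume : Measure α)) :
    ∀ᵐ x, Integrable (fun x' => (gramKernel g x x').toReal * f x') ∧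
      ∫ x', (gramKernel g x x').toReal * f x' = hg.gramOp f x := by
  have hfm := (Lp.stronglyMeasurable f).measurable
  have hfin : ∫⁻ u, (∫⁻ x', g x' u * ‖f x'‖ₑ) ^ 2 ≠ ∞ := by
    refine ne_top_of_le_ne_top ?_ (hg.bound_swap _ hfm.enorm)
    rw [← enorm_Lp_sq]
    simp
  filter_upwards [hg.ae_lintegral_lt_top (hg.swap.measurable_lintegral_mul hfm.enorm) hfin,
    hg.op_ae (hg.swap.op f)] with x hx hopx
  have hm : Measurable fun z : β × α => (g x z.1 : ℝ) * (g z.2 z.1 * f z.2) :=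
    ((hg.measurable_row x).coe_nnreal_real.comp measurable_fst).mul
      ((hg.measurable_coe.comp measurable_swap).mul (hfm.comp measurable_snd))
  have hint : Integrable (Function.uncurry fun u x' => (g x u : ℝ) * (g x' u * f x'))
      ((volume : Measure β).prod (volume : Measure α)) := by
    refine ⟨hm.aestronglyMeasurable, ?_⟩
    refine lt_of_eq_of_lt ?_ hx
    refine (lintegral_prod _ hm.enorm.aemeasurable).trans ?_
    refine lintegral_congr fun u => ?_
    simp only [enorm_mul, NNReal.enorm_eq, Function.swap]
    rw [lintegral_const_mul]
    exact (hg.swap.measurable_row u).coe_nnreal_ennreal.mul hfm.enorm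
  have hinner : ∀ x', ∫ u, (g x u : ℝ) * (g x' u * f x') = (gramKernel g x x').toReal * f x' := by
    intro x'
    simp only [← mul_assoc]
    have hm' : Measurable fun u => (g x u : ℝ) * g x' u :=
      (hg.measurable_row x).coe_nnreal_real.mul (hg.measurable_row x').coe_nnreal_real
    rw [integral_mul_const, gramKernel, integral_eq_lintegral_of_nonneg_ae
      (f := fun u => (g x u : ℝ) * g x' u)
      (ae_of_all _ fun u => mul_nonneg NNReal.zero_le_coe NNReal.zero_le_coe)
      hm'.aestronglyMeasurable]
    congr 2
    refine lintegral_congr fun u => ?_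
    rw [← NNReal.coe_mul, ENNReal.ofReal_coe_nnreal, ENNReal.coe_mul]
  refine ⟨?_, ?_⟩
  · have h := hint.integral_prod_right
    simp only [Function.uncurry, hinner] at h
    exact h
  · rw [ContinuousLinearMap.comp_apply, hopx]
    simp only [← hinner]
    rw [← integral_integral_swap hint]
    refine integral_congr_ae ?_
    filter_upwards [hg.swap.op_ae f] with u hu
    rw [hu, integral_const_mul]

end IsContractiveKernel
end Operator

/-! ### Complete continuity and expansion in mean square -/

section Row

variable {α β : Type*} [MeasureSpace β]

open Classical in
/-- The function `k x` as an element of `L²`, and `0` if it is not square-integrable. -/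
noncomputable def row (k : α → β → ℝ) (x : α) : Lp ℝ 2 (volume : Measure β) :=
  if h : MemLp (k x) 2 then h.toLp _ else 0

variable {k : α → β → ℝ} {x : α}

lemma row_ae (h : MemLp (k x) 2) : row k x =ᵐ[volume] k x := by
  rw [row, dif_pos h]
  exact h.coeFn_toLp

lemma enorm_row_sq (h : MemLp (k x) 2) : ‖row k x‖ₑ ^ 2 = ∫⁻ u, ‖k x u‖ₑ ^ 2 := by
  rw [row, dif_pos h, Lp.enorm_toLp, eLpNorm_two_sq]

lemma inner_row (h : MemLp (k x) 2) (f : Lp ℝ 2 (volume : Measure β)) :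
    ⟪row k x, f⟫ = ∫ u, k x u * f u := by
  rw [inner_Lp]
  refine integral_congr_ae ?_
  filter_upwards [row_ae h] with u hu
  rw [hu]

end Row

section Gram

variable {α β : Type*} [MeasureSpace β]

/-- The kernel of `G G*` with values in `ℝ`; it is `0` where `gramKernel` is infinite. -/
noncomputable def gramReal (g : α → β → ℝ≥0) (x x' : α) : ℝ := (gramKernel g x x').toReal

lemma enorm_gramReal_le (g : α → β → ℝ≥0) (x x' : α) : ‖gramReal g x x'‖ₑ ≤ gramKernel g x x' := by
  rw [gramReal, Real.enorm_of_nonneg ENNReal.toReal_nonneg]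
  exact ENNReal.ofReal_toReal_le

namespace IsContractiveKernel

variable [MeasureSpace α] {g : α → β → ℝ≥0} (hg : IsContractiveKernel g)
  [SigmaFinite (volume : Measure β)]

include hg

lemma measurable_gramReal : Measurable fun z : α × α => gramReal g z.1 z.2 :=
  hg.measurable_gramKernel.ennreal_toReal

variable [SigmaFinite (volume : Measure α)]

/-- The kernels of `G G*` and of `G* G` have the same `L²` norm: both squares are integrals of
`g x u * g x u' * g y u * g y u'` over all four variables. -/
lemma lintegral_gramKernel_swap_sq :
    ∫⁻ w : β × β, gramKernel (Function.swap g) w.1 w.2 ^ 2 =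
      ∫⁻ z : α × α, gramKernel g z.1 z.2 ^ 2 := by
  have h1 : ∀ w : β × β, gramKernel (Function.swap g) w.1 w.2 ^ 2 =
      ∫⁻ z : α × α, (g z.1 w.1 * g z.1 w.2 : ℝ≥0∞) * (g z.2 w.1 * g z.2 w.2) := by
    intro w
    have hw : Measurable fun x => (g x w.1 * g x w.2 : ℝ≥0∞) :=
      (hg.measurable_comp measurable_id measurable_const).mul
        (hg.measurable_comp measurable_id measurable_const)
    rw [sq, gramKernel, Measure.volume_eq_prod]
    exact (lintegral_prod_mul hw.aemeasurable hw.aemeasurable).symm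
  have h2 : ∀ z : α × α, gramKernel g z.1 z.2 ^ 2 =
      ∫⁻ w : β × β, (g z.1 w.1 * g z.1 w.2 : ℝ≥0∞) * (g z.2 w.1 * g z.2 w.2) := by
    intro z
    have hz : Measurable fun u => (g z.1 u * g z.2 u : ℝ≥0∞) :=
      (hg.measurable_comp measurable_const measurable_id).mul
        (hg.measurable_comp measurable_const measurable_id)
    rw [sq, gramKernel, Measure.volume_eq_prod]
    refine (lintegral_prod_mul hz.aemeasurable hz.aemeasurable).symm.trans ?_
    refine lintegral_congr fun w => ?_
    ring
  simp only [h1, h2]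
  refine lintegral_lintegral_swap ?_
  refine Measurable.aemeasurable ?_
  refine ((hg.measurable_comp ?_ ?_).mul (hg.measurable_comp ?_ ?_)).mul
    ((hg.measurable_comp ?_ ?_).mul (hg.measurable_comp ?_ ?_)) <;> fun_prop

lemma measurable_lintegral_gramReal : Measurable fun x => ∫⁻ x', ‖gramReal g x x'‖ₑ ^ 2 :=
  (hg.measurable_gramReal.enorm.pow_const 2).lintegral_prod_right'

variable (hK : ∫⁻ z : α × α, gramKernel g z.1 z.2 ^ 2 ≠ ∞)

include hK

lemma lintegral_gramReal_ne_top : ∫⁻ x, ∫⁻ x', ‖gramReal g x x'‖ₑ ^ 2 ≠ ∞ := by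
  rw [Measure.volume_eq_prod,
    lintegral_prod _ (hg.measurable_gramKernel.pow_const 2).aemeasurable] at hK
  exact ne_top_of_le_ne_top hK (lintegral_mono fun x => lintegral_mono fun x' =>
    pow_le_pow_left' (enorm_gramReal_le g x x') 2)

lemma ae_memLp_gramReal : ∀ᵐ x, MemLp (gramReal g x) 2 := by
  filter_upwards [ae_lt_top hg.measurable_lintegral_gramReal (hg.lintegral_gramReal_ne_top hK)]
    with x hx
  exact memLp_two_of_lintegral (hg.measurable_gramReal.comp
    (by fun_prop : Measurable fun x' : α => (x, x'))).aestronglyMeasurable hx.ne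

lemma ae_inner_row_gramReal (f : Lp ℝ 2 (volume : Measure α)) :
    ∀ᵐ x, ⟪row (gramReal g) x, f⟫ = hg.gramOp f x := by
  filter_upwards [hg.ae_memLp_gramReal hK, hg.gramOp_ae f] with x h1 h2
  rw [inner_row h1, ← h2.2]
  rfl

/-- An integral operator with square-integrable kernel is completely continuous: the values at `x`
are inner products with the row of `x`, and the norms of the rows dominate. -/
lemma isCompletelyContinuous_gramOp : IsCompletelyContinuous hg.gramOp := by
  intro w a hw hlim
  have hsq : Tendsto (fun n => ‖hg.gramOp (w n - a)‖ₑ ^ 2) atTop (𝓝 0) := by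
    simp only [enorm_Lp_sq]
    have h0 : (0 : ℝ≥0∞) = ∫⁻ _ : α, 0 := by simp
    rw [h0]
    refine tendsto_lintegral_of_dominated_convergence
      (fun x => (∫⁻ x', ‖gramReal g x x'‖ₑ ^ 2) * (1 + ‖a‖ₑ) ^ 2) (fun n => ?_)
      (fun n => ?_) ?_ ?_
    · exact (Lp.stronglyMeasurable _).measurable.enorm.pow_const 2
    · filter_upwards [hg.ae_memLp_gramReal hK, hg.ae_inner_row_gramReal hK (w n - a)] with x h1 h2
      rw [← h2, ← enorm_row_sq h1, ← mul_pow]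
      refine pow_le_pow_left' ?_ 2
      have h3 : ‖⟪row (gramReal g) x, w n - a⟫‖ₑ ≤ ‖row (gramReal g) x‖ₑ * ‖w n - a‖ₑ := by
        have := nnnorm_inner_le_nnnorm (𝕜 := ℝ) (row (gramReal g) x) (w n - a)
        simp only [enorm_eq_nnnorm]
        exact_mod_cast this
      refine h3.trans ?_
      gcongr
      refine enorm_sub_le.trans ?_
      gcongr
      rw [← enorm_one (G := ℝ)]
      exact enorm_le_iff_norm_le.2 (by simpa using hw n)
    · rw [lintegral_mul_const _ hg.measurable_lintegral_gramReal]
      refine ENNReal.mul_ne_top (hg.lintegral_gramReal_ne_top hK) ?_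
      simp
    · have hall := ae_all_iff.2 fun n => hg.ae_inner_row_gramReal hK (w n - a)
      filter_upwards [hall] with x hx
      have h1 := (hlim (row (gramReal g) x)).sub_const ⟪a, row (gramReal g) x⟫
      rw [sub_self] at h1
      have h2 := ENNReal.Tendsto.pow (n := 2) h1.enorm
      simp only [enorm_zero, ne_eq, OfNat.ofNat_ne_zero, not_false_eq_true, zero_pow] at h2
      refine h2.congr fun n => ?_
      rw [← hx n, ← inner_sub_left, real_inner_comm]
  rw [tendsto_iff_edist_tendsto_0]
  refine (tendsto_zero_of_sq hsq).congr fun n => ?_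
  rw [edist_eq_enorm_sub, map_sub]

/-- The expansion of the kernel along the eigenfunctions converges in `L²` of the product: it is
the expansion of almost every row, integrated by dominated convergence. -/
lemma tendsto_expansion {lam : ℕ → ℝ} {φ : ℕ → Lp ℝ 2 (volume : Measure α)}
    [SecondCountableTopology (Lp ℝ 2 (volume : Measure α))]
    (hd : IsSpectralSequence hg.gramOp lam φ) :
    Tendsto (fun n : ℕ => eLpNorm (fun z : α × α => gramReal g z.1 z.2 -
      ∑ i ∈ Finset.range n, lam i * φ i z.1 * φ i z.2) 2 volume) atTop (𝓝 0) := by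
  have hφm := fun i => (Lp.stronglyMeasurable (φ i)).measurable
  have hRm : ∀ n : ℕ, Measurable fun z : α × α => gramReal g z.1 z.2 -
      ∑ i ∈ Finset.range n, lam i * φ i z.1 * φ i z.2 := by
    intro n
    refine hg.measurable_gramReal.sub (Finset.measurable_sum _ fun i _ => ?_)
    exact (((hφm i).comp measurable_fst).const_mul _).mul ((hφm i).comp measurable_snd)
  set v := row (gramReal g) with hv
  -- almost every row lies in the closed span of the eigenfunctions
  have hperp : ∀ᵐ x, ∀ h ∈ {h | ∀ i, ⟪φ i, h⟫ = 0}, ⟪v x, h⟫ = 0 := by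
    refine ae_forall_inner_eq_zero v _ fun h hh => ?_
    filter_upwards [hg.ae_inner_row_gramReal hK h,
      Lp.coeFn_zero ℝ 2 (volume : Measure α)] with x hx h0
    rw [hx, hd.ker h hh, h0]
    rfl
  have hcoef : ∀ᵐ x, ∀ i, ⟪φ i, v x⟫ = lam i * φ i x := by
    refine ae_all_iff.2 fun i => ?_
    filter_upwards [hg.ae_inner_row_gramReal hK (φ i), Lp.coeFn_smul (lam i) (φ i)] with x hx h1
    rw [real_inner_comm, hx, hd.eigen, h1]
    rfl
  have hrest : ∀ᵐ x, ∀ n : ℕ, ∫⁻ x', ‖gramReal g x x' -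
      ∑ i ∈ Finset.range n, lam i * φ i x * φ i x'‖ₑ ^ 2 =
        ENNReal.ofReal (⟪v x, v x⟫ - ∑ i ∈ Finset.range n, ⟪φ i, v x⟫ * ⟪φ i, v x⟫) := by
    filter_upwards [hg.ae_memLp_gramReal hK, hcoef] with x h1 h2 n
    have h3 : ‖v x - ∑ i ∈ Finset.range n, ⟪φ i, v x⟫ • φ i‖ ^ 2 =
        ⟪v x, v x⟫ - ∑ i ∈ Finset.range n, ⟪φ i, v x⟫ * ⟪φ i, v x⟫ := by
      rw [norm_sub_sq_real, ← real_inner_self_eq_norm_sq, ← real_inner_self_eq_norm_sq,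
        hd.orthonormal.inner_sum, inner_sum]
      simp only [inner_smul_right, RCLike.conj_to_real, real_inner_comm (φ _) (v x)]
      ring
    rw [← h3, ENNReal.ofReal_pow (norm_nonneg _), ofReal_norm, enorm_Lp_sq]
    refine lintegral_congr_ae ?_
    have h4 := Lp.coeFn_fun_finsetSum (Finset.range n) fun i => ⟪φ i, v x⟫ • φ i
    have h5 := ae_all_iff.2 fun i => Lp.coeFn_smul ⟪φ i, v x⟫ (φ i)
    filter_upwards [row_ae h1, Lp.coeFn_sub (v x) (∑ i ∈ Finset.range n, ⟪φ i, v x⟫ • φ i),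
      h4, h5] with x' h6 h7 h8 h9
    rw [h7, Pi.sub_apply, h6, h8]
    simp_rw [h9, Pi.smul_apply, smul_eq_mul, h2]
  have hsq : Tendsto (fun n : ℕ => ∫⁻ x, ∫⁻ x', ‖gramReal g x x' -
      ∑ i ∈ Finset.range n, lam i * φ i x * φ i x'‖ₑ ^ 2) atTop (𝓝 0) := by
    have h0 : (0 : ℝ≥0∞) = ∫⁻ _ : α, 0 := by simp
    rw [h0]
    refine tendsto_lintegral_of_dominated_convergence (fun x => ∫⁻ x', ‖gramReal g x x'‖ₑ ^ 2)
      (fun n => ((hRm n).enorm.pow_const 2).lintegral_prod_right')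
      (fun n => ?_) (hg.lintegral_gramReal_ne_top hK) ?_
    · filter_upwards [hrest, hg.ae_memLp_gramReal hK] with x h1 h2
      rw [h1, ← enorm_row_sq h2, ← ofReal_norm, ← ENNReal.ofReal_pow (norm_nonneg _),
        ← real_inner_self_eq_norm_sq]
      refine ENNReal.ofReal_le_ofReal (sub_le_self _ ?_)
      exact Finset.sum_nonneg fun i _ => mul_self_nonneg _
    · filter_upwards [hrest, hperp] with x h1 h2
      have h3 := (hasSum_inner_mul_inner_of_orthonormal hd.orthonormal h2 (v x)).tendsto_sum_nat
      have h4 := ENNReal.tendsto_ofReal (h3.const_sub ⟪v x, v x⟫)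
      rw [sub_self, ENNReal.ofReal_zero] at h4
      exact h4.congr fun n => (h1 n).symm
  refine tendsto_zero_of_sq (hsq.congr fun n => ?_)
  rw [eLpNorm_two_sq, Measure.volume_eq_prod,
    lintegral_prod _ ((hRm n).enorm.pow_const 2).aemeasurable]

end IsContractiveKernel
end Gram

/-! ### The Mercer expansion of the kernel of `G G*` -/

section Mercer

variable {α β : Type*} [MeasureSpace α] [MeasureSpace β]

namespace IsContractiveKernel

variable {g : α → β → ℝ≥0} (hg : IsContractiveKernel g)
  [SigmaFinite (volume : Measure α)] [SigmaFinite (volume : Measure β)]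

include hg

lemma isEigenpair_iff {c : ℝ} {φ : α → ℝ} (hφ : MemLp φ 2 volume) :
    IsEigenpair (gramKernel g) c φ ↔ hg.gramOp (hφ.toLp φ) = c • hφ.toLp φ := by
  have hcongr : ∀ x, (fun x' => (gramKernel g x x').toReal * φ x') =ᵐ[volume]
      fun x' => (gramKernel g x x').toReal * hφ.toLp φ x' := fun x => by
    filter_upwards [hφ.coeFn_toLp] with x' hx'
    rw [hx']
  refine ⟨fun h => Lp.ext ?_, fun h => ?_⟩
  · filter_upwards [h, hg.gramOp_ae (hφ.toLp φ), Lp.coeFn_smul c (hφ.toLp φ), hφ.coeFn_toLp]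
      with x h1 h2 h3 h4
    rw [← h2.2, h3, Pi.smul_apply, h4, smul_eq_mul, ← h1.2, integral_congr_ae (hcongr x)]
  · filter_upwards [hg.gramOp_ae (hφ.toLp φ), Lp.coeFn_smul c (hφ.toLp φ), hφ.coeFn_toLp]
      with x h2 h3 h4
    rw [integrable_congr (hcongr x), integral_congr_ae (hcongr x), h2.2, h, h3, Pi.smul_apply, h4,
      smul_eq_mul]
    exact ⟨h2.1, rfl⟩

lemma isEigenpair_coeFn_iff {c : ℝ} (f : Lp ℝ 2 (volume : Measure α)) :
    IsEigenpair (gramKernel g) c f ↔ hg.gramOp f = c • f := by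
  rw [hg.isEigenpair_iff (Lp.memLp f), Lp.toLp_coeFn]

lemma isEigenvalue_iff {lam : ℕ → ℝ} {φ : ℕ → Lp ℝ 2 (volume : Measure α)}
    (hd : IsSpectralSequence hg.gramOp lam φ) {c : ℝ} (hc : c ≠ 0) :
    IsEigenvalue (gramKernel g) c ↔ ∃ i, lam i = c := by
  constructor
  · rintro ⟨f, hf, hf0, he⟩
    refine hd.exists_eq_of_eigenvector (isSymmetric_comp_adjoint hg.inner_op) hc
      (f := hf.toLp f) (fun h => hf0 ?_) ((hg.isEigenpair_iff hf).1 he)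
    exact (hf.coeFn_toLp.symm.trans (by rw [h])).trans (Lp.coeFn_zero _ _ _)
  · rintro ⟨i, rfl⟩
    refine ⟨φ i, Lp.memLp _, fun h => hd.orthonormal.ne_zero i ?_,
      (hg.isEigenpair_coeFn_iff _).2 (hd.eigen i)⟩
    exact Lp.ext (h.trans (Lp.coeFn_zero _ _ _).symm)

/-- Where the diagonal is finite, the kernel is the inner product of two rows of `g`. These rows
are almost everywhere orthogonal to the kernel of `G`, so that Parseval's identity applies. -/
lemma exists_null_hasSum [SecondCountableTopology (Lp ℝ 2 (volume : Measure β))]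
    {lam : ℕ → ℝ} {φ : ℕ → Lp ℝ 2 (volume : Measure α)}
    (hd : IsSpectralSequence hg.gramOp lam φ) :
    ∃ N : Set α, volume N = 0 ∧ ∀ x ∉ N, ∀ x' ∉ N,
      gramKernel g x x ≠ ∞ → gramKernel g x' x' ≠ ∞ → gramKernel g x x' ≠ ∞ ∧
        HasSum (fun i => lam i * φ i x * φ i x') (gramKernel g x x').toReal := by
  set k : α → β → ℝ := fun x u => g x u with hk
  have hkm : ∀ x, Measurable (k x) := fun x => (hg.measurable_row x).coe_nnreal_real
  have hmem : ∀ x, gramKernel g x x ≠ ∞ → MemLp (k x) 2 := fun x hx => by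
    refine memLp_two_of_lintegral (hkm x).aestronglyMeasurable ?_
    simpa [hk, gramKernel, sq] using hx
  -- almost every row is orthogonal to the kernel of `G`
  have hperp : ∀ᵐ x, ∀ h ∈ {h | hg.op h = 0}, ⟪row k x, h⟫ = 0 := by
    refine ae_forall_inner_eq_zero _ _ fun h hh => ?_
    filter_upwards [hg.op_ae h, Lp.coeFn_zero ℝ 2 (volume : Measure α)] with x h1 h2
    by_cases hx : MemLp (k x) 2
    · rw [inner_row hx, ← h1, show hg.op h = 0 from hh, h2]
      rfl
    · rw [row, dif_neg hx, inner_zero_left]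
  -- the coefficients of the row of `x` with respect to `G* (φ i)`
  have hcoef : ∀ᵐ x, ∀ i, ∫ u, k x u * hg.swap.op (φ i) u = lam i * φ i x := by
    refine ae_all_iff.2 fun i => ?_
    filter_upwards [hg.op_ae (hg.swap.op (φ i)), Lp.coeFn_smul (lam i) (φ i)] with x h1 h2
    rw [← h1, ← ContinuousLinearMap.comp_apply, hd.eigen, h2]
    rfl
  refine ⟨{x | ¬ ((∀ h ∈ {h | hg.op h = 0}, ⟪row k x, h⟫ = 0) ∧
    ∀ i, ∫ u, k x u * hg.swap.op (φ i) u = lam i * φ i x)},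
    ae_iff.1 (hperp.and hcoef), fun x hx x' hx' hfin hfin' => ?_⟩
  simp only [Set.mem_ofPred_eq, not_not] at hx hx'
  have hfin2 : gramKernel g x x' ≠ ∞ := by
    have h1 := sq_lintegral_mul_le (μ := volume)
      (hg.measurable_row x).coe_nnreal_ennreal.aemeasurable
      (hg.measurable_row x').coe_nnreal_ennreal.aemeasurable
    simp only [sq (ENNReal.ofNNReal _)] at h1
    intro hcon
    rw [show (∫⁻ u, (g x u : ℝ≥0∞) * g x' u) = ∞ from hcon] at h1
    have h2 := ENNReal.mul_ne_top hfin hfin'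
    simp only [gramKernel] at h2
    simp [h2] at h1
  refine ⟨hfin2, ?_⟩
  have hsum := hd.hasSum_inner_adjoint hg.inner_op (v := row k x) hx.1 (row k x')
  have hval : ⟪row k x, row k x'⟫ = (gramKernel g x x').toReal := by
    rw [inner_row (hmem x hfin), gramKernel]
    have h1 : ∫ u, k x u * row k x' u = ∫ u, k x u * k x' u := by
      refine integral_congr_ae ?_
      filter_upwards [row_ae (hmem x' hfin')] with u hu
      rw [hu]
    rw [h1, integral_eq_lintegral_of_nonneg_ae (f := fun u => k x u * k x' u)
      (ae_of_all _ fun u => mul_nonneg NNReal.zero_le_coe NNReal.zero_le_coe)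
      ((hkm x).mul (hkm x')).aestronglyMeasurable]
    congr 1
    refine lintegral_congr fun u => ?_
    simp only [hk]
    rw [← NNReal.coe_mul, ENNReal.ofReal_coe_nnreal, ENNReal.coe_mul]
  rw [hval] at hsum
  refine hsum.congr_fun fun i => ?_
  rw [real_inner_comm, inner_row (hmem x hfin), hx.2, real_inner_comm,
    inner_row (hmem x' hfin'), hx'.2]
  by_cases hi : lam i = 0
  · simp [hi]
  · field_simp

lemma isMercerExpansion [SecondCountableTopology (Lp ℝ 2 (volume : Measure α))]
    [SecondCountableTopology (Lp ℝ 2 (volume : Measure β))]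
    (hK : ∫⁻ z : α × α, gramKernel g z.1 z.2 ^ 2 ≠ ∞)
    {lam : ℕ → ℝ} {φ : ℕ → Lp ℝ 2 (volume : Measure α)}
    (hd : IsSpectralSequence hg.gramOp lam φ) :
    IsMercerExpansion (gramKernel g) lam fun i => φ i where
  memLp i := Lp.memLp _
  orthonormal i j := by rw [← inner_Lp, orthonormal_iff_ite.1 hd.orthonormal]
  nonneg := hd.nonneg
  antitone := hd.antitone
  eigen i := (hg.isEigenpair_coeFn_iff _).2 (hd.eigen i)
  expansion_L2 := hg.tendsto_expansion hK hd
  expansion_pointwise := hg.exists_null_hasSum hd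

/-- For `w` orthogonal to all eigenfunctions, `T w` is also the image of `w` under each remainder
of the expansion, and the `L²` norms of the remainders tend to zero. -/
lemma isSpectralSequence_of_isMercerExpansion {lam : ℕ → ℝ} {φ : ℕ → α → ℝ}
    (hM : IsMercerExpansion (gramKernel g) lam φ) :
    IsSpectralSequence hg.gramOp lam fun i => (hM.memLp i).toLp (φ i) where
  orthonormal := by
    rw [orthonormal_iff_ite]
    intro i j
    rw [← hM.orthonormal i j, inner_Lp]
    refine integral_congr_ae ?_
    filter_upwards [(hM.memLp i).coeFn_toLp, (hM.memLp j).coeFn_toLp] with x h1 h2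
    rw [h1, h2]
  nonneg := hM.nonneg
  antitone := hM.antitone
  eigen i := (hg.isEigenpair_iff (hM.memLp i)).1 (hM.eigen i)
  ker w hw := by
    have hwm := (Lp.stronglyMeasurable w).measurable
    set φL := fun i => (hM.memLp i).toLp (φ i) with hφL
    have hφm := fun i => (Lp.stronglyMeasurable (φL i)).measurable
    set R : ℕ → α × α → ℝ := fun n z => gramReal g z.1 z.2 -
      ∑ i ∈ Finset.range n, lam i * φL i z.1 * φL i z.2 with hR
    have hRm : ∀ n, Measurable (R n) := by
      intro n
      refine hg.measurable_gramReal.sub (Finset.measurable_sum _ fun i _ => ?_)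
      exact (((hφm i).comp measurable_fst).const_mul _).mul ((hφm i).comp measurable_snd)
    have hRlim : Tendsto (fun n => eLpNorm (R n) 2 volume ^ 2 * ‖w‖ₑ ^ 2) atTop (𝓝 0) := by
      have h1 : Tendsto (fun n => eLpNorm (R n) 2 volume) atTop (𝓝 0) := by
        refine hM.expansion_L2.congr fun n => eLpNorm_congr_ae ?_
        have h2 : ∀ᵐ z : α × α, ∀ i, φL i z.1 = φ i z.1 ∧ φL i z.2 = φ i z.2 := by
          refine ae_all_iff.2 fun i => ?_
          filter_upwards [Measure.quasiMeasurePreserving_fst.ae (hM.memLp i).coeFn_toLp,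
            Measure.quasiMeasurePreserving_snd.ae (hM.memLp i).coeFn_toLp] with z h3 h4
          exact ⟨h3, h4⟩
        filter_upwards [h2] with z hz
        simp only [hR, hz, gramReal]
      have h2 := ENNReal.Tendsto.mul_const (b := ‖w‖ₑ ^ 2) (ENNReal.Tendsto.pow (n := 2) h1)
        (Or.inr (by simp))
      simpa using h2
    have hle : ∀ n, ‖hg.gramOp w‖ₑ ^ 2 ≤ eLpNorm (R n) 2 volume ^ 2 * ‖w‖ₑ ^ 2 := by
      intro n
      have hrow : ∀ᵐ x, hg.gramOp w x = ∫ x', R n (x, x') * w x' := by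
        filter_upwards [hg.gramOp_ae w] with x hx
        have h1 : ∀ i, Integrable fun x' => φL i x' * w x' := fun i =>
          (Lp.memLp (φL i)).integrable_mul (Lp.memLp w)
        have h2 : ∀ x', R n (x, x') * w x' = (gramKernel g x x').toReal * w x' -
            ∑ i ∈ Finset.range n, lam i * φL i x * (φL i x' * w x') := by
          intro x'
          simp only [hR, gramReal, sub_mul, Finset.sum_mul]
          congr 1
          exact Finset.sum_congr rfl fun i _ => by ring
        simp only [h2]
        rw [integral_sub hx.1 (integrable_finsetSum _ fun i _ => (h1 i).const_mul _), hx.2,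
          integral_finsetSum _ fun i _ => (h1 i).const_mul _, Finset.sum_eq_zero, sub_zero]
        intro i _
        rw [integral_const_mul, ← inner_Lp, hw i, mul_zero]
      rw [enorm_Lp_sq, eLpNorm_two_sq, Measure.volume_eq_prod,
        lintegral_prod _ ((hRm n).enorm.pow_const 2).aemeasurable,
        ← lintegral_mul_const _ ((hRm n).enorm.pow_const 2).lintegral_prod_right']
      refine lintegral_mono_ae ?_
      filter_upwards [hrow] with x hx
      rw [hx, enorm_Lp_sq]
      refine le_trans (pow_le_pow_left' (enorm_integral_le_lintegral_enorm _) 2) ?_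
      simp only [enorm_mul]
      exact sq_lintegral_mul_le ((hRm n).comp
        (by fun_prop : Measurable fun x' : α => (x, x'))).enorm.aemeasurable hwm.enorm.aemeasurable
    have h0 : ‖hg.gramOp w‖ₑ ^ 2 ≤ 0 := ge_of_tendsto' hRlim hle
    simpa using h0

lemma exists_isSpectralSequence_gramOp
    [TopologicalSpace.SeparableSpace (Lp ℝ 2 (volume : Measure α))]
    (hK : ∫⁻ z : α × α, gramKernel g z.1 z.2 ^ 2 ≠ ∞)
    (hfin : ¬ FiniteDimensional ℝ (Lp ℝ 2 (volume : Measure α))) :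
    ∃ lam φ, IsSpectralSequence hg.gramOp lam φ :=
  exists_isSpectralSequence hfin (isSymmetric_comp_adjoint hg.inner_op)
    (fun f => by rw [inner_comp_adjoint hg.inner_op]; exact real_inner_self_nonneg)
    (hg.isCompletelyContinuous_gramOp hK)

end IsContractiveKernel

lemma IsEigenpair.congr {K K' : α → α → ℝ≥0∞} {c : ℝ} {φ : α → ℝ}
    (h : ∀ᵐ x, ∀ᵐ x', K x x' = K' x x') (he : IsEigenpair K c φ) : IsEigenpair K' c φ := by
  filter_upwards [h, he] with x h1 h2
  have h3 : (fun x' => (K x x').toReal * φ x') =ᵐ[volume] fun x' => (K' x x').toReal * φ x' := by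
    filter_upwards [h1] with x' hx'
    rw [hx']
  rw [← integrable_congr h3, ← integral_congr_ae h3]
  exact h2

lemma IsMercerExpansion.congr [SFinite (volume : Measure α)] {K K' : α → α → ℝ≥0∞} {lam : ℕ → ℝ}
    {φ : ℕ → α → ℝ} {N : Set α} (hN : volume N = 0)
    (h : ∀ x ∉ N, ∀ x' ∉ N, K x x' = K' x x') (hM : IsMercerExpansion K lam φ) :
    IsMercerExpansion K' lam φ where
  memLp := hM.memLp
  orthonormal := hM.orthonormal
  nonneg := hM.nonneg
  antitone := hM.antitone
  eigen i := by
    have hN' : ∀ᵐ x, x ∉ N := measure_eq_zero_iff_ae_notMem.1 hN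
    refine (hM.eigen i).congr ?_
    filter_upwards [hN'] with x hx
    filter_upwards [hN'] with x' hx'
    exact h x hx x' hx'
  expansion_L2 := by
    have hN' : ∀ᵐ x, x ∉ N := measure_eq_zero_iff_ae_notMem.1 hN
    refine hM.expansion_L2.congr fun n => eLpNorm_congr_ae ?_
    filter_upwards [Measure.quasiMeasurePreserving_fst.ae hN',
      Measure.quasiMeasurePreserving_snd.ae hN'] with z h1 h2
    rw [h _ h1 _ h2]
  expansion_pointwise := by
    obtain ⟨N', hN', hs⟩ := hM.expansion_pointwise
    refine ⟨N ∪ N', measure_union_null hN hN', fun x hx x' hx' => ?_⟩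
    simp only [Set.mem_union, not_or] at hx hx'
    rw [← h x hx.1 x' hx'.1, ← h x hx.1 x hx.1, ← h x' hx'.1 x' hx'.1]
    exact hs x hx.2 x' hx'.2

lemma IsEigenvalue.congr {K K' : α → α → ℝ≥0∞} {c : ℝ}
    (h : ∀ᵐ x, ∀ᵐ x', K x x' = K' x x') (he : IsEigenvalue K c) : IsEigenvalue K' c := by
  obtain ⟨φ, h1, h2, h3⟩ := he
  exact ⟨φ, h1, h2, h3.congr h⟩

end Mercer

/-! ### The kernel of a joint density -/

section Density

/-- A conditional density has total mass at most `1`. The mass is `0` if the normalizing constant is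
`0` or `∞`, since division by `0` gives `0`. -/
lemma lintegral_div_le_one {β : Type*} [MeasureSpace β] (f : β → ℝ≥0) :
    ∫⁻ u, ((f u / (∫⁻ v, (f v : ℝ≥0∞)).toNNReal : ℝ≥0) : ℝ≥0∞) ≤ 1 := by
  set r := (∫⁻ v, (f v : ℝ≥0∞)).toNNReal with hr
  by_cases h0 : r = 0
  · simp [h0]
  have htop : ∫⁻ v, (f v : ℝ≥0∞) ≠ ∞ := fun h => h0 (by rw [hr, h]; rfl)
  simp only [ENNReal.coe_div h0]
  simp only [div_eq_mul_inv]
  rw [lintegral_mul_const' _ _ (ENNReal.inv_ne_top.2 (ENNReal.coe_ne_zero.2 h0)), hr,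
    ENNReal.coe_toNNReal htop]
  exact ENNReal.mul_inv_le_one _

variable {α β : Type*} [MeasureSpace α] [MeasureSpace β]

/-- `p` is a measurable joint probability density. The last condition follows from the others by
Tonelli's theorem; it is included to make the notion symmetric. -/
structure IsJointDensity (p : α → β → ℝ≥0) : Prop where
  measurable : Measurable fun z : α × β => p z.1 z.2
  lintegral_marginal : ∫⁻ x, marginal p x = 1
  lintegral_marginal_swap : ∫⁻ u, marginal (Function.swap p) u = 1

lemma IsJointDensity.swap {p : α → β → ℝ≥0} (hp : IsJointDensity p) :
    IsJointDensity (Function.swap p) :=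
  ⟨hp.measurable.comp measurable_swap, hp.lintegral_marginal_swap, hp.lintegral_marginal⟩

/-- The kernel `p(x, u) / (p(x)^(1/2) p(u)^(1/2))`. The cross density kernels are the kernels of
`G G*` and `G* G` for its integral operator `G`. It is `0` where a marginal density is `0` or
`∞`. -/
noncomputable def rootKernel (p : α → β → ℝ≥0) (x : α) (u : β) : ℝ≥0 :=
  p x u / (NNReal.sqrt (marginal p x).toNNReal *
    NNReal.sqrt (marginal (Function.swap p) u).toNNReal)

/-- The square root of a marginal density, which is an eigenfunction with eigenvalue `1`. -/
noncomputable def sqrtMarginal (p : α → β → ℝ≥0) (x : α) : ℝ≥0 :=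
  NNReal.sqrt (marginal p x).toNNReal

lemma rootKernel_swap (p : α → β → ℝ≥0) :
    rootKernel (Function.swap p) = Function.swap (rootKernel p) := by
  ext u x
  simp only [rootKernel, Function.swap]
  rw [mul_comm]

namespace IsJointDensity

variable {p : α → β → ℝ≥0} (hp : IsJointDensity p)

include hp

lemma measurable_row (x : α) : Measurable (p x) :=
  hp.measurable.comp (by fun_prop : Measurable fun u : β => (x, u))

variable [SigmaFinite (volume : Measure β)]

lemma measurable_marginal : Measurable (marginal p) :=
  hp.measurable.coe_nnreal_ennreal.lintegral_prod_right'

lemma ae_marginal_ne_top : ∀ᵐ x, marginal p x ≠ ∞ := by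
  filter_upwards [ae_lt_top hp.measurable_marginal (by rw [hp.lintegral_marginal]; simp)] with x hx
  exact hx.ne

lemma measurable_sqrtMarginal : Measurable (sqrtMarginal p) :=
  NNReal.continuous_sqrt.measurable.comp hp.measurable_marginal.ennreal_toNNReal

variable [SigmaFinite (volume : Measure α)]

lemma measurable_rootKernel : Measurable fun z : α × β => rootKernel p z.1 z.2 :=
  hp.measurable.div ((hp.measurable_sqrtMarginal.comp measurable_fst).mul
    (hp.swap.measurable_sqrtMarginal.comp measurable_snd))

/-- The contraction property, by the Cauchy–Schwarz inequality applied to the factors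
`(p(x, u) / p(x))^(1/2)` and `(p(x, u) / p(u))^(1/2)` of the kernel. -/
lemma rootKernel_bound (h : β → ℝ≥0∞) (hh : Measurable h) :
    ∫⁻ x, (∫⁻ u, rootKernel p x u * h u) ^ 2 ≤ ∫⁻ u, h u ^ 2 := by
  set r := fun x => (marginal p x).toNNReal with hr
  set s := fun u => (marginal (Function.swap p) u).toNNReal with hs
  have hrm : Measurable r := hp.measurable_marginal.ennreal_toNNReal
  have hsm : Measurable s := hp.swap.measurable_marginal.ennreal_toNNReal
  have hfac : ∀ x u, rootKernel p x u = NNReal.sqrt (p x u / r x) * NNReal.sqrt (p x u / s u) := by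
    intro x u
    rw [NNReal.sqrt_div, NNReal.sqrt_div, div_mul_div_comm, NNReal.mul_self_sqrt]
    rfl
  have hsq : ∀ a : ℝ≥0, (NNReal.sqrt a : ℝ≥0∞) ^ 2 = a := fun a => by
    rw [← ENNReal.coe_pow, NNReal.sq_sqrt]
  have hbm : Measurable fun z : α × β => ((p z.1 z.2 / s z.2 : ℝ≥0) : ℝ≥0∞) * h z.2 ^ 2 :=
    (hp.measurable.div (hsm.comp measurable_snd)).coe_nnreal_ennreal.mul
      ((hh.comp measurable_snd).pow_const 2)
  calc ∫⁻ x, (∫⁻ u, rootKernel p x u * h u) ^ 2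
      ≤ ∫⁻ x, ∫⁻ u, ((p x u / s u : ℝ≥0) : ℝ≥0∞) * h u ^ 2 := by
        refine lintegral_mono fun x => ?_
        have h1 : Measurable fun u => (NNReal.sqrt (p x u / r x) : ℝ≥0∞) :=
          (NNReal.continuous_sqrt.measurable.comp
            ((hp.measurable_row x).div_const _)).coe_nnreal_ennreal
        have h2 : Measurable fun u => (NNReal.sqrt (p x u / s u) : ℝ≥0∞) * h u :=
          (NNReal.continuous_sqrt.measurable.comp
            ((hp.measurable_row x).div hsm)).coe_nnreal_ennreal.mul hh
        have h3 := sq_lintegral_mul_le (μ := volume) h1.aemeasurable h2.aemeasurable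
        simp only [hfac, ENNReal.coe_mul, mul_assoc]
        refine h3.trans ?_
        simp only [mul_pow, hsq]
        refine (mul_le_mul_left (lintegral_div_le_one (p x)) _).trans_eq (one_mul _)
    _ = ∫⁻ u, ∫⁻ x, ((p x u / s u : ℝ≥0) : ℝ≥0∞) * h u ^ 2 :=
        lintegral_lintegral_swap hbm.aemeasurable
    _ ≤ ∫⁻ u, h u ^ 2 := by
        refine lintegral_mono fun u => ?_
        have h1 : Measurable fun x => ((p x u / s u : ℝ≥0) : ℝ≥0∞) :=
          ((hp.swap.measurable_row u).div_const _).coe_nnreal_ennreal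
        rw [lintegral_mul_const _ h1]
        exact (mul_le_mul_left (lintegral_div_le_one fun x => p x u) _).trans_eq (one_mul _)

lemma isContractiveKernel : IsContractiveKernel (rootKernel p) where
  measurable := hp.measurable_rootKernel
  bound := hp.rootKernel_bound
  bound_swap h hh := by
    have := hp.swap.rootKernel_bound h hh
    rwa [rootKernel_swap] at this

/-- Where a marginal density vanishes, so does the joint density, almost everywhere. -/
lemma ae_ae_eq_zero : ∀ᵐ x, ∀ᵐ u, marginal (Function.swap p) u = 0 → p x u = 0 := by
  have h1 : ∀ᵐ u, ∀ᵐ x, marginal (Function.swap p) u = 0 → p x u = 0 := by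
    refine ae_of_all _ fun u => ?_
    by_cases hu : marginal (Function.swap p) u = 0
    · have h2 := (lintegral_eq_zero_iff (hp.swap.measurable_row u).coe_nnreal_ennreal).1 hu
      filter_upwards [h2] with x hx _
      simpa using hx
    · exact ae_of_all _ fun x h => absurd h hu
  refine (Measure.ae_ae_comm ?_).1 h1
  have h2 : MeasurableSet {z : β × α | marginal (Function.swap p) z.1 = 0 → p z.2 z.1 = 0} := by
    have h3 : MeasurableSet {z : β × α | marginal (Function.swap p) z.1 = 0} :=
      (hp.swap.measurable_marginal.comp measurable_fst) (measurableSet_singleton 0)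
    have h4 : MeasurableSet {z : β × α | p z.2 z.1 = 0} :=
      hp.swap.measurable (measurableSet_singleton 0)
    exact h3.imp h4
  exact h2

/-- Off a null set, the cross density kernel is the kernel of `G G*`. -/
lemma exists_null_crossKernel_eq : ∃ N : Set α, volume N = 0 ∧ ∀ x ∉ N, ∀ x' ∉ N,
    crossKernel p x x' = gramKernel (rootKernel p) x x' := by
  refine ⟨{x | ¬ (marginal p x ≠ ∞ ∧ ∀ᵐ u, marginal (Function.swap p) u = 0 → p x u = 0)},
    ae_iff.1 (hp.ae_marginal_ne_top.and hp.ae_ae_eq_zero), fun x hx x' hx' => ?_⟩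
  simp only [Set.mem_ofPred_eq, not_not] at hx hx'
  have hroot : ∀ y, marginal p y = 0 → ∀ u, rootKernel p y u = 0 := fun y hy u => by
    simp [rootKernel, hy]
  by_cases h0 : marginal p x = 0
  · simp [crossKernel, crossDensity, gramKernel, hroot x h0, h0]
  by_cases h0' : marginal p x' = 0
  · have h1 := (lintegral_eq_zero_iff (hp.measurable_row x').coe_nnreal_ennreal).1 h0'
    have h2 : crossDensity p x x' = 0 := by
      rw [crossDensity, ← lintegral_zero (μ := (volume : Measure β))]
      refine lintegral_congr_ae ?_
      filter_upwards [h1] with u hu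
      simp only [Pi.zero_apply, ENNReal.coe_eq_zero] at hu
      simp [condDensity, Function.swap, hu]
    simp [crossKernel, h2, gramKernel, hroot x' h0']
  obtain ⟨r, hr⟩ : ∃ r : ℝ≥0, (r : ℝ≥0∞) = marginal p x := ⟨_, ENNReal.coe_toNNReal hx.1⟩
  obtain ⟨r', hr'⟩ : ∃ r : ℝ≥0, (r : ℝ≥0∞) = marginal p x' := ⟨_, ENNReal.coe_toNNReal hx'.1⟩
  have hr0 : r ≠ 0 := fun h => h0 (by rw [← hr, h]; rfl)
  have hr0' : r' ≠ 0 := fun h => h0' (by rw [← hr', h]; rfl)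
  have hpow : ∀ a : ℝ≥0, (a : ℝ≥0∞) ^ (1 / 2 : ℝ) = (NNReal.sqrt a : ℝ≥0∞) := fun a => by
    rw [NNReal.sqrt_eq_rpow, ENNReal.coe_rpow_of_nonneg _ (by norm_num)]
  have hs0 : NNReal.sqrt r * NNReal.sqrt r' ≠ 0 :=
    mul_ne_zero (NNReal.sqrt_eq_zero.not.2 hr0) (NNReal.sqrt_eq_zero.not.2 hr0')
  rw [crossKernel, crossDensity, ← hr, ← hr', hpow, hpow, ← ENNReal.coe_mul, div_eq_mul_inv,
    ← lintegral_mul_const' _ _ (ENNReal.inv_ne_top.2 (ENNReal.coe_ne_zero.2 hs0)), gramKernel]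
  refine lintegral_congr_ae ?_
  filter_upwards [hx.2, hx'.2, hp.swap.ae_marginal_ne_top] with u h1 h1' h2
  obtain ⟨s, hs⟩ : ∃ s : ℝ≥0, (s : ℝ≥0∞) = marginal (Function.swap p) u :=
    ⟨_, ENNReal.coe_toNNReal h2⟩
  simp only [condDensity, rootKernel, Function.swap_def] at hs h1 h1' ⊢
  rw [← hr, ← hr', ← hs]
  -- where the second marginal density vanishes, both sides are zero
  by_cases hs0' : s = 0
  · have hm : marginal (fun y x => p x y) u = 0 := by rw [← hs, hs0']; rfl
    rw [h1 hm, h1' hm]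
    simp
  simp only [ENNReal.toNNReal_coe]
  rw [← ENNReal.coe_inv hs0, ← ENNReal.coe_div hs0', ← ENNReal.coe_div hr0]
  norm_cast
  have hss := NNReal.mul_self_sqrt s
  have h3 : NNReal.sqrt r ≠ 0 := NNReal.sqrt_eq_zero.not.2 hr0
  have h4 : NNReal.sqrt r' ≠ 0 := NNReal.sqrt_eq_zero.not.2 hr0'
  have h5 : NNReal.sqrt s ≠ 0 := NNReal.sqrt_eq_zero.not.2 hs0'
  have h6 : p x' u / s = p x' u / (NNReal.sqrt s * NNReal.sqrt s) := by rw [hss]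
  rw [h6]
  field_simp

end IsJointDensity

/-- Changing the joint density on a null set changes the kernel on a null set of points. -/
lemma exists_null_crossKernel_congr [SFinite (volume : Measure α)]
    [SFinite (volume : Measure β)] {p p' : α → β → ℝ≥0}
    (h : ∀ᵐ z : α × β, p z.1 z.2 = p' z.1 z.2) : ∃ N : Set α, volume N = 0 ∧ ∀ x ∉ N, ∀ x' ∉ N,
    crossKernel p x x' = crossKernel p' x x' := by
  rw [Measure.volume_eq_prod] at h
  have h1 : ∀ᵐ x, ∀ᵐ u, p x u = p' x u := Measure.ae_ae_of_ae_prod h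
  have h2 : ∀ᵐ u, ∀ᵐ x, p x u = p' x u :=
    Measure.ae_ae_of_ae_prod (Measure.measurePreserving_swap.quasiMeasurePreserving.ae h)
  refine ⟨{x | ¬ ∀ᵐ u, p x u = p' x u}, ae_iff.1 h1, fun x hx x' hx' => ?_⟩
  simp only [Set.mem_ofPred_eq, not_not] at hx hx'
  have hm : ∀ y, (∀ᵐ u, p y u = p' y u) → marginal p y = marginal p' y := fun y hy => by
    refine lintegral_congr_ae ?_
    filter_upwards [hy] with u hu
    rw [hu]
  rw [crossKernel, crossKernel, hm x hx, hm x' hx']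
  congr 1
  refine lintegral_congr_ae ?_
  filter_upwards [hx, hx', h2] with u h3 h4 h5
  have h6 : marginal (Function.swap p) u = marginal (Function.swap p') u := by
    refine lintegral_congr_ae ?_
    filter_upwards [h5] with y hy
    rw [Function.swap, hy]
  simp only [condDensity, h6, hm x hx, Function.swap_def, h3, h4]

end Density

/-! ### The eigenvalue one and independence -/

section Dependence

variable {α β : Type*} [MeasureSpace α] [MeasureSpace β]

namespace IsJointDensity

variable {p : α → β → ℝ≥0} (hp : IsJointDensity p)

include hp

variable [SigmaFinite (volume : Measure β)]

lemma ae_sqrtMarginal_sq : ∀ᵐ x, (sqrtMarginal p x : ℝ≥0∞) ^ 2 = marginal p x := by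
  filter_upwards [hp.ae_marginal_ne_top] with x hx
  rw [sqrtMarginal, ← ENNReal.coe_pow, NNReal.sq_sqrt, ENNReal.coe_toNNReal hx]

lemma memLp_sqrtMarginal : MemLp (fun x => (sqrtMarginal p x : ℝ)) 2 volume := by
  refine memLp_two_of_lintegral hp.measurable_sqrtMarginal.coe_nnreal_real.aestronglyMeasurable ?_
  simp only [NNReal.enorm_eq]
  rw [lintegral_congr_ae hp.ae_sqrtMarginal_sq, hp.lintegral_marginal]
  simp

lemma memLp_indicator_sqrtMarginal {A : Set α} (hA : MeasurableSet A) :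
    MemLp (A.indicator fun x => (sqrtMarginal p x : ℝ)) 2 volume :=
  hp.memLp_sqrtMarginal.indicator hA

/-- The square root of the marginal density, restricted to `A`, as an element of `L²`. -/
noncomputable def sqrtOn {A : Set α} (hA : MeasurableSet A) : Lp ℝ 2 (volume : Measure α) :=
  (hp.memLp_indicator_sqrtMarginal hA).toLp _

lemma sqrtOn_ae {A : Set α} (hA : MeasurableSet A) :
    hp.sqrtOn hA =ᵐ[volume] A.indicator fun x => (sqrtMarginal p x : ℝ) :=
  (hp.memLp_indicator_sqrtMarginal hA).coeFn_toLp

lemma inner_sqrtOn_univ {A : Set α} (hA : MeasurableSet A) :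
    ⟪hp.sqrtOn .univ, hp.sqrtOn hA⟫ = (∫⁻ x in A, marginal p x).toReal := by
  have h1 : ⟪hp.sqrtOn .univ, hp.sqrtOn hA⟫ = ∫ x in A, (sqrtMarginal p x : ℝ) ^ 2 := by
    rw [inner_Lp, ← integral_indicator hA]
    refine integral_congr_ae ?_
    filter_upwards [hp.sqrtOn_ae .univ, hp.sqrtOn_ae hA] with x h2 h3
    rw [h2, h3]
    by_cases hx : x ∈ A <;> simp [hx, sq]
  rw [h1, integral_eq_lintegral_of_nonneg_ae (ae_of_all _ fun x => by positivity)
    (hp.measurable_sqrtMarginal.coe_nnreal_real.pow_const 2).aestronglyMeasurable]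
  congr 1
  refine lintegral_congr_ae ?_
  filter_upwards [ae_restrict_of_ae hp.ae_sqrtMarginal_sq] with x hx
  rw [← hx, ← NNReal.coe_pow, ENNReal.ofReal_coe_nnreal, ENNReal.coe_pow]

lemma norm_sqrtOn_univ : ‖hp.sqrtOn .univ‖ = 1 := by
  have h := hp.inner_sqrtOn_univ .univ
  rw [real_inner_self_eq_norm_sq, setLIntegral_univ, hp.lintegral_marginal, ENNReal.toReal_one] at h
  exact (pow_eq_one_iff_of_nonneg (norm_nonneg _) two_ne_zero).1 h

variable [SigmaFinite (volume : Measure α)]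

/-- `G` maps `p(u)^(1/2)` restricted to `B` to the function `P(x, B) / p(x)^(1/2)`, where `P(x, B)`
is the integral of `p(x, u)` over `B`. -/
lemma op_sqrtOn_ae {B : Set β} (hB : MeasurableSet B) :
    ∀ᵐ x, hp.isContractiveKernel.op (hp.swap.sqrtOn hB) x =
      (∫⁻ u in B, p x u).toReal / sqrtMarginal p x := by
  filter_upwards [hp.isContractiveKernel.op_ae (hp.swap.sqrtOn hB), hp.ae_ae_eq_zero] with x h1 h2
  have h3 : ∀ᵐ u, (rootKernel p x u : ℝ) * hp.swap.sqrtOn hB u =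
      B.indicator (fun u => (p x u : ℝ)) u / sqrtMarginal p x := by
    filter_upwards [hp.swap.sqrtOn_ae hB, h2, hp.swap.ae_marginal_ne_top] with u h4 h5 h6
    rw [h4]
    by_cases hu : u ∈ B
    swap
    · simp [hu]
    rw [Set.indicator_of_mem hu, Set.indicator_of_mem hu]
    have h7 : rootKernel p x u = p x u / (sqrtMarginal p x * sqrtMarginal (Function.swap p) u) :=
      rfl
    by_cases h8 : sqrtMarginal (Function.swap p) u = 0
    · have h9 : p x u = 0 := h5 <| by
        rw [sqrtMarginal, NNReal.sqrt_eq_zero, ENNReal.toNNReal_eq_zero_iff] at h8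
        exact h8.resolve_right h6
      simp [h7, h9]
    · rw [h7]
      have h9 : (sqrtMarginal (Function.swap p) u : ℝ) ≠ 0 := NNReal.coe_ne_zero.2 h8
      push_cast
      rw [← div_div, div_mul_cancel₀ _ h9]
  rw [h1, integral_congr_ae h3, integral_div, integral_indicator hB,
    integral_eq_lintegral_of_nonneg_ae (ae_of_all _ fun u => NNReal.zero_le_coe)
      (hp.measurable_row x).coe_nnreal_real.aestronglyMeasurable]
  simp only [ENNReal.ofReal_coe_nnreal]

/-- `G` maps the square root of one marginal density to that of the other. -/
lemma op_sqrtOn_univ :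
    hp.isContractiveKernel.op (hp.swap.sqrtOn .univ) = hp.sqrtOn .univ := by
  refine Lp.ext ?_
  filter_upwards [hp.op_sqrtOn_ae .univ, hp.sqrtOn_ae .univ] with x h1 h2
  have h3 : ((marginal p x).toReal : ℝ) = sqrtMarginal p x * sqrtMarginal p x := by
    rw [sqrtMarginal, ← NNReal.coe_mul, NNReal.mul_self_sqrt]
    rfl
  rw [h1, h2, Set.indicator_univ, setLIntegral_univ,
    show (∫⁻ u, (p x u : ℝ≥0∞)) = marginal p x from rfl, h3, mul_self_div_self]

lemma swap_op_sqrtOn_univ :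
    hp.isContractiveKernel.swap.op (hp.sqrtOn .univ) = hp.swap.sqrtOn .univ := by
  refine Lp.ext ?_
  have h1 := hp.swap.op_sqrtOn_univ
  have h2 := hp.swap.isContractiveKernel.op_ae (hp.sqrtOn .univ)
  rw [show hp.swap.isContractiveKernel.op (hp.sqrtOn .univ) = _ from h1] at h2
  refine (hp.isContractiveKernel.swap.op_ae _).trans (EventuallyEq.trans ?_ h2.symm)
  rw [rootKernel_swap]

/-- The bilinear form of `G` at restricted square roots of the marginals is the joint law. -/
lemma inner_op_sqrtOn {A : Set α} (hA : MeasurableSet A) {B : Set β} (hB : MeasurableSet B) :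
    ⟪hp.isContractiveKernel.op (hp.swap.sqrtOn hB), hp.sqrtOn hA⟫ =
      (∫⁻ x in A, ∫⁻ u in B, p x u).toReal := by
  have hm : Measurable fun x => ∫⁻ u in B, (p x u : ℝ≥0∞) :=
    hp.measurable.coe_nnreal_ennreal.lintegral_prod_right'
  have hle : ∀ x, ∫⁻ u in B, (p x u : ℝ≥0∞) ≤ marginal p x := fun x => setLIntegral_le_lintegral _ _
  have h1 : ⟪hp.isContractiveKernel.op (hp.swap.sqrtOn hB), hp.sqrtOn hA⟫ =
      ∫ x in A, (∫⁻ u in B, (p x u : ℝ≥0∞)).toReal := by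
    rw [inner_Lp, ← integral_indicator hA]
    refine integral_congr_ae ?_
    filter_upwards [hp.op_sqrtOn_ae hB, hp.sqrtOn_ae hA, hp.ae_marginal_ne_top]
      with x h2 h3 h4
    rw [h2, h3]
    by_cases hx : x ∈ A
    swap
    · simp [hx]
    rw [Set.indicator_of_mem hx, Set.indicator_of_mem hx]
    by_cases h5 : sqrtMarginal p x = 0
    · have h6 : marginal p x = 0 := by
        rw [sqrtMarginal, NNReal.sqrt_eq_zero, ENNReal.toNNReal_eq_zero_iff] at h5
        exact h5.resolve_right h4
      have h7 : ∫⁻ u in B, (p x u : ℝ≥0∞) = 0 := le_antisymm (h6 ▸ hle x) zero_le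
      simp [h7]
    · exact div_mul_cancel₀ _ (NNReal.coe_ne_zero.2 h5)
  rw [h1, integral_toReal hm.aemeasurable]
  refine ae_restrict_of_ae ?_
  filter_upwards [hp.ae_marginal_ne_top] with x hx
  exact (hle x).trans_lt (lt_top_iff_ne_top.2 hx)

/-- For a product density, `G` has rank one. -/
lemma op_eq_of_prod (h : ∀ᵐ x, ∀ᵐ u, (p x u : ℝ≥0∞) = marginal p x * marginal (Function.swap p) u)
    (k : Lp ℝ 2 (volume : Measure β)) :
    hp.isContractiveKernel.op k = ⟪hp.swap.sqrtOn .univ, k⟫ • hp.sqrtOn .univ := by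
  refine Lp.ext ?_
  filter_upwards [hp.isContractiveKernel.op_ae k, hp.sqrtOn_ae .univ, hp.ae_marginal_ne_top, h,
    Lp.coeFn_smul ⟪hp.swap.sqrtOn .univ, k⟫ (hp.sqrtOn .univ)] with x h1 h2 h3 h4 h5
  rw [h1, h5, Pi.smul_apply, h2, Set.indicator_univ, smul_eq_mul, inner_Lp, ← integral_mul_const]
  refine integral_congr_ae ?_
  filter_upwards [h4, hp.swap.ae_marginal_ne_top, hp.swap.sqrtOn_ae .univ] with u h6 h7 h8
  rw [h8, Set.indicator_univ]
  have h9 : p x u = (sqrtMarginal p x * sqrtMarginal (Function.swap p) u) *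
      (sqrtMarginal p x * sqrtMarginal (Function.swap p) u) := by
    have h10 : p x u = (marginal p x).toNNReal * (marginal (Function.swap p) u).toNNReal := by
      rw [← ENNReal.toNNReal_mul, ← h6, ENNReal.toNNReal_coe]
    rw [mul_mul_mul_comm, sqrtMarginal, sqrtMarginal, NNReal.mul_self_sqrt, NNReal.mul_self_sqrt,
      h10]
  have h11 : rootKernel p x u = sqrtMarginal p x * sqrtMarginal (Function.swap p) u := by
    have h12 : rootKernel p x u = p x u / (sqrtMarginal p x * sqrtMarginal (Function.swap p) u) :=
      rfl
    rw [h12, h9, mul_self_div_self]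
  rw [h11]
  push_cast
  ring

section Independence

variable {Ω : Type*} [MeasurableSpace Ω] {P : Measure Ω}
  {x : Ω → α} {u : Ω → β} (hx : Measurable x) (hu : Measurable u)
  (hdens : P.map (fun ω => (x ω, u ω)) =
    (volume : Measure (α × β)).withDensity fun z => (p z.1 z.2 : ℝ≥0∞))

include hx hu hdens

lemma measure_inter_preimage {A : Set α} (hA : MeasurableSet A) {B : Set β}
    (hB : MeasurableSet B) : P (x ⁻¹' A ∩ u ⁻¹' B) = ∫⁻ a in A, ∫⁻ b in B, p a b := by
  have h1 : P (x ⁻¹' A ∩ u ⁻¹' B) = P.map (fun ω => (x ω, u ω)) (A ×ˢ B) := by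
    rw [Measure.map_apply (hx.prodMk hu) (hA.prod hB)]
    rfl
  rw [h1, hdens, withDensity_apply _ (hA.prod hB), Measure.volume_eq_prod,
    ← Measure.prod_restrict, lintegral_prod _ hp.measurable.coe_nnreal_ennreal.aemeasurable]

lemma map_fst_eq : P.map x = (volume : Measure α).withDensity (marginal p) := by
  ext A hA
  rw [Measure.map_apply hx hA, withDensity_apply _ hA]
  have h := hp.measure_inter_preimage hx hu hdens hA .univ
  rw [Set.preimage_univ, Set.inter_univ] at h
  simp only [setLIntegral_univ] at h
  exact h

lemma map_snd_eq : P.map u = (volume : Measure β).withDensity (marginal (Function.swap p)) := by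
  ext B hB
  rw [Measure.map_apply hu hB, withDensity_apply _ hB]
  have h := hp.measure_inter_preimage hx hu hdens .univ hB
  rw [setLIntegral_univ, lintegral_lintegral_swap
    hp.measurable.coe_nnreal_ennreal.aemeasurable, Set.preimage_univ, Set.univ_inter] at h
  exact h

lemma ae_eq_mul_of_indepFun [IsProbabilityMeasure P] (hind : IndepFun x u P) :
    ∀ᵐ a, ∀ᵐ b, (p a b : ℝ≥0∞) = marginal p a * marginal (Function.swap p) b := by
  have h1 := (indepFun_iff_map_prod_eq_prod_map_map hx.aemeasurable hu.aemeasurable).1 hind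
  rw [hdens, hp.map_fst_eq hx hu hdens, hp.map_snd_eq hx hu hdens,
    prod_withDensity hp.measurable_marginal hp.swap.measurable_marginal,
    ← Measure.volume_eq_prod] at h1
  refine Measure.ae_ae_of_ae_prod (p := fun z : α × β => (p z.1 z.2 : ℝ≥0∞) =
    marginal p z.1 * marginal (Function.swap p) z.2) ?_
  rw [← Measure.volume_eq_prod]
  refine (withDensity_eq_iff hp.measurable.coe_nnreal_ennreal.aemeasurable
    ((hp.measurable_marginal.comp measurable_fst).mul
      (hp.swap.measurable_marginal.comp measurable_snd)).aemeasurable ?_).1 h1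
  have h2 := hp.lintegral_marginal
  rw [Measure.volume_eq_prod, lintegral_prod _ hp.measurable.coe_nnreal_ennreal.aemeasurable,
    show (∫⁻ a, ∫⁻ b, (p a b : ℝ≥0∞)) = 1 from h2]
  simp

/-- Independence means that `G` has rank one, hence that there is one nonzero eigenvalue. -/
lemma indepFun_iff [IsProbabilityMeasure P] {lam : ℕ → ℝ} {φ : ℕ → Lp ℝ 2 (volume : Measure α)}
    (hd : IsSpectralSequence hp.isContractiveKernel.gramOp lam φ) :
    IndepFun x u P ↔ ∀ i, 1 ≤ i → lam i = 0 := by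
  have hadj := hp.isContractiveKernel.inner_op
  have h0 := hd.lam_zero_eq_one hadj hp.isContractiveKernel.swap.norm_op_le hp.norm_sqrtOn_univ
    hp.op_sqrtOn_univ hp.swap_op_sqrtOn_univ
  constructor
  · intro hind i hi
    refine hd.lam_eq_zero_of_rank_one (s := hp.sqrtOn .univ) h0 (fun f => ?_) hi
    rw [ContinuousLinearMap.comp_apply,
      hp.op_eq_of_prod (hp.ae_eq_mul_of_indepFun hx hu hdens hind), ← hadj, hp.op_sqrtOn_univ]
  · intro hlam
    rw [indepFun_iff_measure_inter_preimage_eq_mul]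
    intro A B hA hB
    have h1 := hd.inner_eq_of_lam_eq_zero hadj h0 hlam hp.norm_sqrtOn_univ hp.op_sqrtOn_univ
      hp.swap_op_sqrtOn_univ (hp.swap.sqrtOn hB) (hp.sqrtOn hA)
    rw [hp.inner_op_sqrtOn hA hB, hp.inner_sqrtOn_univ hA, hp.swap.inner_sqrtOn_univ hB,
      ← hp.measure_inter_preimage hx hu hdens hA hB, ← withDensity_apply _ hA,
      ← withDensity_apply _ hB, ← hp.map_fst_eq hx hu hdens, ← hp.map_snd_eq hx hu hdens,
      Measure.map_apply hx hA, Measure.map_apply hu hB, ← ENNReal.toReal_mul] at h1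
    exact (ENNReal.toReal_eq_toReal_iff' (measure_ne_top _ _)
      (ENNReal.mul_ne_top (measure_ne_top _ _) (measure_ne_top _ _))).1 h1

end Independence

end IsJointDensity

end Dependence

/-- Indicators of disjoint unit cubes are orthonormal. -/
lemma not_finiteDimensional_Lp_pi {ι : Type*} [Fintype ι] [Nonempty ι] :
    ¬ FiniteDimensional ℝ (Lp ℝ 2 (volume : Measure (ι → ℝ))) := by
  intro hfd
  let A : ℕ → Set (ι → ℝ) := fun n => Set.pi Set.univ fun _ => Set.Ioc (n : ℝ) (n + 1)
  have hA : ∀ n, MeasurableSet (A n) := fun n => MeasurableSet.univ_pi fun _ => measurableSet_Ioc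
  have hvol : ∀ n, volume (A n) = 1 := fun n => by
    simp [A, Real.volume_Ioc, volume_pi_pi]
  have hfin : ∀ n, volume (A n) ≠ ∞ := fun n => by simp [hvol]
  have hdisj : ∀ m n, m ≠ n → A m ∩ A n = ∅ := by
    intro m n hmn
    ext y
    simp only [A, Set.mem_inter_iff, Set.mem_pi, Set.mem_univ, true_imp_iff, Set.mem_Ioc,
      Set.mem_empty_iff_false, iff_false, not_and]
    intro h1 h2
    obtain ⟨j⟩ := ‹Nonempty ι›
    have h3 := h1 j
    have h4 := h2 j
    refine hmn (le_antisymm ?_ ?_)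
    · have : (m : ℝ) < n + 1 := by linarith
      exact Nat.lt_succ_iff.1 (by exact_mod_cast this)
    · have : (n : ℝ) < m + 1 := by linarith
      exact Nat.lt_succ_iff.1 (by exact_mod_cast this)
  have horth : Orthonormal ℝ fun n => indicatorConstLp 2 (hA n) (hfin n) (1 : ℝ) := by
    rw [orthonormal_iff_ite]
    intro m n
    rw [L2.inner_indicatorConstLp_indicatorConstLp (hμs := hfin m) (hμt := hfin n)]
    split_ifs with h
    · simp [h, Measure.real, hvol]
    · simp [hdisj m n h]
  have hfinite : Finite ℕ := horth.linearIndependent.finite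
  exact not_finite ℕ

/-! ### Passage to the cross density kernels -/

section Transfer

variable {α β : Type*} [MeasureSpace α] [MeasureSpace β]

lemma ae_ae_eq_of_null {K K' : α → α → ℝ≥0∞} {N : Set α} (hN : volume N = 0)
    (h : ∀ x ∉ N, ∀ x' ∉ N, K x x' = K' x x') : ∀ᵐ x, ∀ᵐ x', K x x' = K' x x' := by
  have hN' : ∀ᵐ x, x ∉ N := measure_eq_zero_iff_ae_notMem.1 hN
  filter_upwards [hN'] with x hx
  filter_upwards [hN'] with x' hx'
  exact h x hx x' hx'

variable [SigmaFinite (volume : Measure α)] [SigmaFinite (volume : Measure β)]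

/-- For a density with measurable modification `q`, the cross density kernel agrees off a null set
with the kernel of `G G*`. -/
lemma IsJointDensity.exists_null_crossKernel_eq_of_ae {p q : α → β → ℝ≥0} (hq : IsJointDensity q)
    (h : ∀ᵐ z : α × β, p z.1 z.2 = q z.1 z.2) : ∃ N : Set α, volume N = 0 ∧ ∀ x ∉ N, ∀ x' ∉ N,
    crossKernel p x x' = gramKernel (rootKernel q) x x' := by
  obtain ⟨N, hN, h1⟩ := exists_null_crossKernel_congr h
  obtain ⟨N', hN', h2⟩ := hq.exists_null_crossKernel_eq
  refine ⟨N ∪ N', measure_union_null hN hN', fun x hx x' hx' => ?_⟩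
  simp only [Set.mem_union, not_or] at hx hx'
  rw [h1 x hx.1 x' hx'.1, h2 x hx.2 x' hx'.2]

/-- A kernel that agrees with that of `G G*` off a null set has a Mercer expansion, its eigenvalue
sequence is unique, and it contains all nonzero eigenvalues. Uniqueness compares an arbitrary
expansion with the spectral sequence of `G* G`. -/
lemma IsContractiveKernel.mercer_of_null
    [SecondCountableTopology (Lp ℝ 2 (volume : Measure α))]
    [SecondCountableTopology (Lp ℝ 2 (volume : Measure β))]
    {g : α → β → ℝ≥0} (hg : IsContractiveKernel g)
    (hK : ∫⁻ z : α × α, gramKernel g z.1 z.2 ^ 2 ≠ ∞) {K : α → α → ℝ≥0∞} {N : Set α}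
    (hN : volume N = 0) (h : ∀ x ∉ N, ∀ x' ∉ N, K x x' = gramKernel g x x')
    {lam : ℕ → ℝ} {φ : ℕ → Lp ℝ 2 (volume : Measure α)} {ψ : ℕ → Lp ℝ 2 (volume : Measure β)}
    (hd : IsSpectralSequence hg.gramOp lam φ) (hd' : IsSpectralSequence hg.swap.gramOp lam ψ) :
    (∃ φ : ℕ → α → ℝ, IsMercerExpansion K lam φ) ∧
    (∀ (lam' : ℕ → ℝ) (φ' : ℕ → α → ℝ), IsMercerExpansion K lam' φ' → lam' = lam) ∧
    ∀ c : ℝ, c ≠ 0 → (IsEigenvalue K c ↔ ∃ i, lam i = c) := by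
  have h' : ∀ x ∉ N, ∀ x' ∉ N, gramKernel g x x' = K x x' :=
    fun x hx x' hx' => (h x hx x' hx').symm
  refine ⟨⟨_, (hg.isMercerExpansion hK hd).congr hN h'⟩, fun lam' φ' hM => ?_, fun c hc => ?_⟩
  · exact ((hg.isSpectralSequence_of_isMercerExpansion (hM.congr hN h)).eq_of_adjoint
      hg.inner_op hd').symm
  · rw [← hg.isEigenvalue_iff hd hc]
    exact ⟨.congr (ae_ae_eq_of_null hN h), .congr (ae_ae_eq_of_null hN h')⟩

end Transfer
end CrossDensity

open CrossDensity in
theorem mainTheorem5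
    {Ω : Type*} [MeasurableSpace Ω] (P : Measure Ω) [IsProbabilityMeasure P]
    (T₁ T₂ : ℕ) (hT₁ : 1 ≤ T₁) (hT₂ : 1 ≤ T₂)
    (x : Ω → (Fin T₁ → ℝ)) (u : Ω → (Fin T₂ → ℝ)) (hx : Measurable x) (hu : Measurable u)
    -- `p` is a joint density of `x` and `u` with respect to Lebesgue measure
    (p : (Fin T₁ → ℝ) → (Fin T₂ → ℝ) → ℝ≥0)
    (hp : AEMeasurable (fun z : (Fin T₁ → ℝ) × (Fin T₂ → ℝ) => p z.1 z.2) volume)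
    (hdens : P.map (fun ω => (x ω, u ω)) =
      (volume : Measure ((Fin T₁ → ℝ) × (Fin T₂ → ℝ))).withDensity
        (fun z => (p z.1 z.2 : ℝ≥0∞)))
    -- the kernel `K(x, x')` is square-integrable
    (hK : ∫⁻ z : (Fin T₁ → ℝ) × (Fin T₁ → ℝ), CrossDensity.crossKernel p z.1 z.2 ^ 2 ≠ ∞) :
    ∃ lam : ℕ → ℝ,
      -- both kernels have a Mercer expansion, with the same eigenvalues
      (∃ φ : ℕ → (Fin T₁ → ℝ) → ℝ,
        CrossDensity.IsMercerExpansion (CrossDensity.crossKernel p) lam φ) ∧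
      (∃ ψ : ℕ → (Fin T₂ → ℝ) → ℝ,
        CrossDensity.IsMercerExpansion (CrossDensity.crossKernel (Function.swap p)) lam ψ) ∧
      -- the eigenvalue sequence is determined by either kernel
      (∀ (lam' : ℕ → ℝ) (φ' : ℕ → (Fin T₁ → ℝ) → ℝ),
        CrossDensity.IsMercerExpansion (CrossDensity.crossKernel p) lam' φ' → lam' = lam) ∧
      (∀ (lam' : ℕ → ℝ) (ψ' : ℕ → (Fin T₂ → ℝ) → ℝ),
        CrossDensity.IsMercerExpansion (CrossDensity.crossKernel (Function.swap p)) lam' ψ' →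
          lam' = lam) ∧
      -- it contains every nonzero eigenvalue of either operator
      (∀ c : ℝ, c ≠ 0 →
        (CrossDensity.IsEigenvalue (CrossDensity.crossKernel p) c ↔ ∃ i, lam i = c) ∧
        (CrossDensity.IsEigenvalue (CrossDensity.crossKernel (Function.swap p)) c ↔
          ∃ i, lam i = c)) ∧
      -- it measures dependence
      lam 0 = 1 ∧
      (IndepFun x u P ↔ ∀ i, 1 ≤ i → lam i = 0) := by
  have : Nonempty (Fin T₁) := ⟨⟨0, hT₁⟩⟩
  have : Nonempty (Fin T₂) := ⟨⟨0, hT₂⟩⟩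
  -- a measurable modification of the density
  set q : (Fin T₁ → ℝ) → (Fin T₂ → ℝ) → ℝ≥0 := fun a b => hp.mk _ (a, b) with hqdef
  have hpq : ∀ᵐ z : (Fin T₁ → ℝ) × (Fin T₂ → ℝ), p z.1 z.2 = q z.1 z.2 := hp.ae_eq_mk
  have hpq' : ∀ᵐ z : (Fin T₂ → ℝ) × (Fin T₁ → ℝ),
      Function.swap p z.1 z.2 = Function.swap q z.1 z.2 :=
    Measure.measurePreserving_swap.quasiMeasurePreserving.ae hpq
  have hqm : Measurable fun z : (Fin T₁ → ℝ) × (Fin T₂ → ℝ) => q z.1 z.2 := hp.measurable_mk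
  have hdq : P.map (fun ω => (x ω, u ω)) =
      (volume : Measure ((Fin T₁ → ℝ) × (Fin T₂ → ℝ))).withDensity
        fun z => (q z.1 z.2 : ℝ≥0∞) := by
    rw [hdens]
    refine withDensity_congr_ae ?_
    filter_upwards [hpq] with z hz
    rw [hz]
  have htot : ∫⁻ a, ∫⁻ b, (q a b : ℝ≥0∞) = 1 := by
    have h1 : P.map (fun ω => (x ω, u ω)) Set.univ = 1 := by
      rw [Measure.map_apply (hx.prodMk hu) .univ, Set.preimage_univ, measure_univ]
    rwa [hdq, withDensity_apply _ .univ, setLIntegral_univ, Measure.volume_eq_prod,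
      lintegral_prod _ hqm.coe_nnreal_ennreal.aemeasurable] at h1
  have hq : IsJointDensity q := ⟨hqm, htot, by
    rwa [lintegral_lintegral_swap hqm.coe_nnreal_ennreal.aemeasurable] at htot⟩
  have : Fact ((2 : ℝ≥0∞) ≠ ∞) := ⟨ENNReal.ofNat_ne_top⟩
  set g := rootKernel q with hgdef
  have hg : IsContractiveKernel g := hq.isContractiveKernel
  obtain ⟨N, hN, hKN⟩ := hq.exists_null_crossKernel_eq_of_ae hpq
  obtain ⟨N', hN', hKN'⟩ := hq.swap.exists_null_crossKernel_eq_of_ae hpq'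
  rw [rootKernel_swap] at hKN'
  have hKg : ∫⁻ z : (Fin T₁ → ℝ) × (Fin T₁ → ℝ), gramKernel g z.1 z.2 ^ 2 ≠ ∞ := by
    have hae : ∀ᵐ y : Fin T₁ → ℝ, y ∉ N := measure_eq_zero_iff_ae_notMem.1 hN
    refine ne_of_eq_of_ne (lintegral_congr_ae ?_) hK
    filter_upwards [Measure.quasiMeasurePreserving_fst.ae hae,
      Measure.quasiMeasurePreserving_snd.ae hae] with z h1 h2
    rw [hKN _ h1 _ h2]
  have hKg' : ∫⁻ w : (Fin T₂ → ℝ) × (Fin T₂ → ℝ),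
      gramKernel (Function.swap g) w.1 w.2 ^ 2 ≠ ∞ := by
    rwa [hg.lintegral_gramKernel_swap_sq]
  obtain ⟨lam, φ, hd⟩ := hg.exists_isSpectralSequence_gramOp hKg not_finiteDimensional_Lp_pi
  obtain ⟨lam', ψ, hd'⟩ :=
    hg.swap.exists_isSpectralSequence_gramOp hKg' not_finiteDimensional_Lp_pi
  obtain rfl : lam' = lam := hd.eq_of_adjoint hg.inner_op hd'
  obtain ⟨h1, h2, h3⟩ := hg.mercer_of_null hKg hN hKN hd hd'
  obtain ⟨h1', h2', h3'⟩ := hg.swap.mercer_of_null hKg' hN' hKN' hd' hd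
  exact ⟨lam', h1, h1', h2, h2', fun c hc => ⟨h3 c hc, h3' c hc⟩,
    hd.lam_zero_eq_one hg.inner_op hg.swap.norm_op_le hq.norm_sqrtOn_univ hq.op_sqrtOn_univ
      hq.swap_op_sqrtOn_univ,
    hq.indepFun_iff hx hu hdq hd⟩
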